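/- Let $\mathbb T^2=\mathbb R^2/\mathbb Z^2$ with Lebesgue measure of total mass $1$, $\langle u,v\rangle=\int_{\mathbb T^2}\overline u\,v\,dx$, and $V\in C^\infty(\mathbb T^2,\mathbb R)$. Here $\hbar\to0^+$ either continuously or along a fixed sequence. Let $\varepsilon_\hbar>0$ satisfy $\hbar^2\ll\varepsilon_\hbar\ll\hbar$, that is, $\hbar^2/\varepsilon_\hbar\to0$ and $\varepsilon_\hbar/\hbar\to0$ as $\hbar\to0^+$, and put $\tau^c_\hbar=\hbar/\varepsilon_\hbar$. Let $(\psi_\hbar)$ be a family in $L^2(\mathbb T^2)$ with $\|\psi_\hbar\|_{L^2}=1$, oscillating at frequency $\hbar^{-1}$ in the sense that $$\lim_{\delta\to0^+}\limsup_{\hbar\to0^+}\big\|\mathbf 1_{[0,\delta]}(-\hbar^2\Delta)\psi_\hbar\big\|_{L^2}=0,\qquad \lim_{R\to+\infty}\limsup_{\hbar\to0^+}\big\|\mathbf 1_{[R,+\infty[}(-\hbar^2\Delta)\psi_\hbar\big\|_{L^2}=0 .$$ Let $u_\hbar$ and $u^\varepsilon_\hbar$ be the solutions in $C^0(\mathbb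 R,L^2(\mathbb T^2))$, with the same initial condition $\psi_\hbar$ at time $0$, of $$i\hbar\,\partial_tu_\hbar=-\tfrac{\hbar^2}{2}\Delta u_\hbar,\qquad i\hbar\,\partial_tu^\varepsilon_\hbar=-\tfrac{\hbar^2}{2}\Delta u^\varepsilon_\hbar+\varepsilon_\hbar V u^\varepsilon_\hbar .$$ Let $\mathcal L_1$ be the set of primitive rank-$1$ sublattices $\Lambda$ of $\mathbb Z^2$, that is, those whose real span $\langle\Lambda\rangle$ is one-dimensional and satisfies $\langle\Lambda\rangle\cap\mathbb Z^2=\Lambda$. For $\Lambda\in\mathcal L_1$ choose a generator $\vec v_\Lambda$, let $\vec v_\Lambda^\perp$ be its rotation by $+\pi/2$, and put $L_\Lambda=\|\vec v_\Lambda\|$, $H_\Lambda(\xi)=\langle\xi,\vec v_\Lambda\rangle/L_\Lambda$ and $$\mathcal I_\Lambda(b)(x)=\frac1{L_\Lambda}\int_0^{L_\Lambda}b\Big(x+t\,\frac{\vec v^\perp_\Lambda}{L_\Lambda}\Big)dt ,$$ acting in the variable $x$ only when $b$ depends on further variables. Let $\mathrm{Op}_\hbar$ be the standard quantization on $\mathbb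 T^2$, $\mathrm{Op}_\hbar(a)e_k=a(x,2\pi\hbar k)\,e_k$ for $e_k(x)=e^{2i\pi k\cdot x}$, $k\in\mathbb Z^2$. Assume that, for every $\Lambda\in\mathcal L_1$, there is a finite positive measure $\mathbf F^0_\Lambda$ on $\mathbb T^2\times\mathbb R$ such that, for every $a\in C_c^\infty(\mathbb T^2\times\mathbb R)$, $$\lim_{\hbar\to0^+}\Big\langle\psi_\hbar,\mathrm{Op}_\hbar\Big(\mathcal I_\Lambda(a)\Big(x,\frac{\hbar H_\Lambda(\xi)}{\varepsilon_\hbar}\Big)\Big)\psi_\hbar\Big\rangle=\int_{\mathbb T^2\times\mathbb R}a\,d\mathbf F^0_\Lambda .$$ Then $\sum_{\Lambda\in\mathcal L_1}\langle\mathbf F^0_\Lambda,1\rangle<\infty$ and, for every $t\in\mathbb R$, $$\lim_{\hbar\to0^+}\big\langle u^\varepsilon_\hbar(t\tau^c_\hbar),u_\hbar(t\tau^c_\hbar)\big\rangle=e^{it\int_{\mathbb T^2}V}\Big(1-\sum_{\Lambda\in\mathcal L_1}\langle\mathbf F^0_\Lambda,1\rangle\Big)+\sum_{\Lambda\in\mathcal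 L_1}\int_{\mathbb T^2\times\mathbb R}\exp\Big(i\int_0^t\mathcal I_\Lambda(V)\Big(x+s\,\frac{\eta\,\vec v_\Lambda}{L_\Lambda}\Big)ds\Big)\,\mathbf F^0_\Lambda(dx,d\eta).$$ -/

import Mathlib

open MeasureTheory Filter Topology
open scoped ContDiff ENNReal

namespace LoschmidtEcho

noncomputable section

/-- The standard torus `ℝ² / ℤ²`. -/
abbrev Torus : Type := UnitAddTorus (Fin 2)

/-- The Lebesgue measure of total mass `1` on the torus. -/
abbrev torusMeasure : Measure Torus :=
  Measure.pi fun _ : Fin 2 => (AddCircle.haarAddCircle : Measure UnitAddCircle)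

/-- The complex Hilbert space `L²(𝕋²)`; its inner product `inner ℂ u v` is `∫ conj u * v`. -/
abbrev L2Torus : Type := Lp ℂ 2 torusMeasure

/-- The covering map `ℝ² → ℝ² / ℤ²`. -/
def proj (y : Fin 2 → ℝ) : Torus := fun i => (y i : UnitAddCircle)

/-- Functions on the torus which are `C^∞`, i.e. whose periodic lift to `ℝ²` is `C^∞`. -/
def SmoothOnTorus {E : Type*} [NormedAddCommGroup E] [NormedSpace ℝ E] (f : Torus → E) : Prop :=
  ContDiff ℝ ∞ fun y : Fin 2 → ℝ => f (proj y)

/-- The space `C_c^∞(𝕋² × ℝ)` of complex valued test functions. -/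
def IsTestFunction (a : Torus × ℝ → ℂ) : Prop :=
  ContDiff ℝ ∞ (fun p : (Fin 2 → ℝ) × ℝ => a (proj p.1, p.2)) ∧ HasCompactSupport a

/-! ### The Laplacian and the Schrödinger equation -/

/-- The partial derivative in the direction of the `j`-th coordinate. -/
def torusPartial (j : Fin 2) (f : Torus → ℂ) (x : Torus) : ℂ :=
  deriv (fun s : ℝ => f (x + proj (Pi.single j s))) 0

/-- The Laplacian `Δ = ∂₁² + ∂₂²` on the torus (for smooth functions). -/
def torusLaplacian (f : Torus → ℂ) (x : Torus) : ℂ :=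
  ∑ j : Fin 2, torusPartial j (torusPartial j f) x

/-- `u ∈ C⁰(ℝ, L²(𝕋²))` solves `i h ∂ₜ u = - h² Δ u / 2 + W u`, `u(0) = ψ`, where the equation
holds in the sense of distributions on the torus (tested against all smooth functions). -/
structure IsSchrodingerSolution (h : ℝ) (W : Torus → ℝ) (ψ : L2Torus) (u : ℝ → L2Torus) :
    Prop where
  continuous : Continuous u
  initial : u 0 = ψ
  equation : ∀ φ : Torus → ℂ, SmoothOnTorus φ → ∀ t : ℝ,
    HasDerivAt (fun s : ℝ => Complex.I * (h : ℂ) * ∫ x, φ x * u s x ∂torusMeasure)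
      (∫ x, (-((h : ℂ) ^ 2 / 2) * torusLaplacian φ x + (W x : ℂ) * φ x) * u t x ∂torusMeasure) t

/-! ### Spectral projectors of the Laplacian and the standard quantization

The functions `e_k(x) = exp(2 i π k·x)`, `k ∈ ℤ²`, form the Hilbert basis of eigenfunctions of
`-Δ`, with eigenvalues `4 π² ‖k‖²`. -/

/-- The eigenvalue of `- h² Δ` on `e_k`. -/
def laplaceEigenvalue (h : ℝ) (k : Fin 2 → ℤ) : ℝ :=
  h ^ 2 * (4 * Real.pi ^ 2 * ((k 0 : ℝ) ^ 2 + (k 1 : ℝ) ^ 2))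

/-- The spectral projector `𝟏_S(- h² Δ)`. -/
def spectralProjector (h : ℝ) (S : Set ℝ) (u : L2Torus) : L2Torus :=
  ∑' k : Fin 2 → ℤ, Set.indicator {k | laplaceEigenvalue h k ∈ S}
    (fun k => UnitAddTorus.mFourierCoeff u k • (UnitAddTorus.mFourierLp 2 k : L2Torus)) k

open Classical in
/-- The class in `L²(𝕋²)` of a square integrable function. -/
def toL2 (f : Torus → ℂ) : L2Torus :=
  if hf : MemLp f 2 torusMeasure then hf.toLp f else 0

/-- The standard quantization of a symbol `a(x, ξ)` on `T*𝕋²`, acting on `L²(𝕋²)`: it is given by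
`Op_h(a) e_k = a(·, 2πhk) e_k`, extended to `L²` by (unconditionally convergent) Fourier series. -/
def quantize (h : ℝ) (a : Torus → (Fin 2 → ℝ) → ℂ) (u : L2Torus) : L2Torus :=
  ∑' k : Fin 2 → ℤ, UnitAddTorus.mFourierCoeff u k •
    toL2 fun x => a x (fun i => 2 * Real.pi * h * (k i : ℝ)) * UnitAddTorus.mFourier k x

/-! ### Primitive sublattices of rank one -/

/-- The real subspace spanned by a sublattice of `ℤ²`. -/
def realSpan (Λ : AddSubgroup (Fin 2 → ℤ)) : Submodule ℝ (Fin 2 → ℝ) :=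
  Submodule.span ℝ {y | ∃ k ∈ Λ, y = fun i => (k i : ℝ)}

/-- The sublattices `Λ` of `ℤ²` of rank `1` which are primitive, i.e. `⟨Λ⟩ ∩ ℤ² = Λ`. -/
def IsPrimitiveRankOne (Λ : AddSubgroup (Fin 2 → ℤ)) : Prop :=
  Module.finrank ℝ (realSpan Λ) = 1 ∧
    ∀ k : Fin 2 → ℤ, (fun i => (k i : ℝ)) ∈ realSpan Λ ↔ k ∈ Λ

/-- The family of all primitive sublattices of rank `1`. -/
abbrev PrimitiveLattice : Type := {Λ : AddSubgroup (Fin 2 → ℤ) // IsPrimitiveRankOne Λ}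

/-- The Euclidean length of a lattice vector. -/
def vecLength (v : Fin 2 → ℤ) : ℝ := √((v 0 : ℝ) ^ 2 + (v 1 : ℝ) ^ 2)

/-- The unit vector `v / ‖v‖`. -/
def unitVec (v : Fin 2 → ℤ) : Fin 2 → ℝ := fun i => (v i : ℝ) / vecLength v

/-- The lattice vector directly orthogonal to `v`, of the same length. -/
def perp (v : Fin 2 → ℤ) : Fin 2 → ℤ := ![-v 1, v 0]

/-- The Hamiltonian `H(ξ) = ⟨ξ, v⟩ / ‖v‖`. -/
def latticeHamiltonian (v : Fin 2 → ℤ) (ξ : Fin 2 → ℝ) : ℝ := ∑ i, ξ i * unitVec v i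

/-- The average `(1/L) ∫₀ᴸ b (x + t v^⊥ / L) dt`, `L = ‖v‖`, of `b` along the closed orbits
directed by `v^⊥`. -/
def latticeAverage {E : Type*} [NormedAddCommGroup E] [NormedSpace ℝ E]
    (v : Fin 2 → ℤ) (b : Torus → E) (x : Torus) : E :=
  (vecLength v)⁻¹ • ∫ t in (0 : ℝ)..vecLength v, b (x + proj (t • unitVec (perp v)))

/-- The symbol `(x, ξ) ↦ I(a)(x, h H(ξ) / ε)`. -/
def twoMicrolocalSymbol (v : Fin 2 → ℤ) (h ε : ℝ) (a : Torus × ℝ → ℂ) :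
    Torus → (Fin 2 → ℝ) → ℂ :=
  fun x ξ => latticeAverage v (fun y => a (y, h * latticeHamiltonian v ξ / ε)) x

/-- The two-microlocal distribution `a ↦ ⟨ψ, Op_h(I(a)(x, h H(ξ) / ε)) ψ⟩`. -/
def twoMicrolocal (v : Fin 2 → ℤ) (h ε : ℝ) (ψ : L2Torus) (a : Torus × ℝ → ℂ) : ℂ :=
  inner ℂ ψ (quantize h (twoMicrolocalSymbol v h ε a) ψ)

end

end LoschmidtEcho

open LoschmidtEcho

/-!
In the interaction picture and in the time unit `ħ / ε`, the perturbed solution `w` solves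
`w' = -i B(t) w`, `w(0) = ψ`, where `B(t)` is the multiplication by `V` conjugated by the free flow
(`IsSchrodingerSolution.hasDerivAt_interaction`), and the echo is `⟨w(t), ψ⟩`. The operators `B(t)`
are symmetric and bounded by `sup |V|`, uniformly in `ħ`. With `κ = 4 π² ħ² / ε → 0`, the
multiplication by `e_p` conjugated by the free flow at time `r` is
`e_m ↦ exp(i r κ (m·p + |p|² / 2)) e_{m + p}`; such operators commute up to `O(κ)`.

*Slicing.* Cut `[0, t]` into `n` slices and replace `V` by a real trigonometric polynomial at
distance `δ`. Then `⟨w(t), ψ⟩` is, up to `O(1 / n + δ)` uniformly in `ħ`, the quadratic form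
`⟨ψ, ∏ (1 + i ∫ B) ψ⟩` with one factor per slice (`norm_inner_sub_backwardSlices_le`); only operator
norms enter here. Expanding the product gives finitely many *words*, that is, products of operators
"multiply by `e_p`, conjugate by the free flow, integrate over `[a, b]`". Up to `O(κ)`, a word with
letters `(p_i, a_i, b_i)` acts by `e_m ↦ ∏ oscInt a_i b_i (κ m·p_i) e_{m + ∑ p_i}`, and
`oscInt a b θ = ∫_a^b exp(i r θ) dr` is small for large `θ`.

*Limits of words* (`tendsto_inner_wordVec`). If all `p_i` vanish, the word is a constant. If two of
the `p_i` are linearly independent, its weight is small unless `κ |m|` is bounded, that is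
`ħ |m| = O(ε / ħ)`, and there the family `ψ` has no mass. In the remaining case all `p_i` lie in
exactly one primitive lattice `Λ`, the weight is a smooth function of `κ m·v_Λ` vanishing at
infinity, and the limit is given by the measure `F Λ`. The three cases are expressed by one formula,
`meanValue F σ`, where the symbol `σ` of a word is the product of the symbols of its letters,
evaluated on all the resonant regions (a point `some (Λ, x, η)`) and on the nonresonant one (`none`),
whose mass is `1 - ∑ F_Λ(1)`. The resonant masses are summable because the resonant regions of
different lattices are disjoint up to low frequencies (`summable_resonant_mass`).

*Conclusion.* By linearity the sliced quadratic form converges to the mean value of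
`∏ (1 + i ∫ (orbit average of V))`, one factor per slice, which is uniformly close to
`exp(i ∫_0^t (orbit average of V))` (`norm_prod_sliceSymbol_sub_echoSymbol_le`); the mean value of
this exponential is the right-hand side of the theorem.
-/

namespace LoschmidtEcho

noncomputable section

/-! ### Fourier coefficients and weighted shifts -/

/-- The index set `ℤ²` of the Fourier basis. -/
abbrev Freq : Type := Fin 2 → ℤ

/-- The Fourier coefficients of an element of `L²(𝕋²)`. -/
def fc (φ : L2Torus) (n : Freq) : ℂ := UnitAddTorus.mFourierCoeff φ n

/-- The Hilbert basis `(e_k)` of `L²(𝕋²)`, for the measure `torusMeasure`. -/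
def torusBasis : HilbertBasis Freq ℂ L2Torus := UnitAddTorus.mFourierBasis

/-- The basis vector `e_n` as an element of `L²(𝕋²)`. -/
def basisVec (n : Freq) : L2Torus := UnitAddTorus.mFourierLp 2 n

lemma torusBasis_apply (n : Freq) : torusBasis n = basisVec n :=
  congrFun UnitAddTorus.coe_mFourierBasis n

lemma torusBasis_repr (φ : L2Torus) (n : Freq) : torusBasis.repr φ n = fc φ n :=
  UnitAddTorus.mFourierBasis_repr φ n

lemma fc_eq_inner (φ : L2Torus) (n : Freq) : fc φ n = inner ℂ (basisVec n) φ := by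
  rw [← torusBasis_repr, HilbertBasis.repr_apply_apply, torusBasis_apply]

lemma fc_add (φ χ : L2Torus) (n : Freq) : fc (φ + χ) n = fc φ n + fc χ n := by
  simp [fc_eq_inner, inner_add_right]

lemma fc_sub (φ χ : L2Torus) (n : Freq) : fc (φ - χ) n = fc φ n - fc χ n := by
  simp [fc_eq_inner, inner_sub_right]

lemma fc_smul (c : ℂ) (φ : L2Torus) (n : Freq) : fc (c • φ) n = c * fc φ n := by
  simp [fc_eq_inner, inner_smul_right]

lemma fc_sum {α : Type*} (s : Finset α) (φ : α → L2Torus) (n : Freq) :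
    fc (∑ i ∈ s, φ i) n = ∑ i ∈ s, fc (φ i) n := by
  simp [fc_eq_inner, inner_sum]

lemma ext_fc {φ χ : L2Torus} (h : ∀ n, fc φ n = fc χ n) : φ = χ := by
  apply torusBasis.repr.injective
  ext n
  rw [torusBasis_repr, torusBasis_repr, h n]

lemma memℓp_fc (φ : L2Torus) : Memℓp (fc φ) 2 := by
  have h : (fun n => torusBasis.repr φ n) = fc φ := funext fun n => torusBasis_repr φ n
  rw [← h]
  exact lp.memℓp (torusBasis.repr φ)

lemma summable_sq_fc (φ : L2Torus) : Summable fun n => ‖fc φ n‖ ^ 2 := by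
  have := (memℓp_gen_iff (by norm_num)).1 (memℓp_fc φ)
  simpa using this

lemma norm_sq_eq_tsum (φ : L2Torus) : ‖φ‖ ^ 2 = ∑' n, ‖fc φ n‖ ^ 2 := by
  rw [← torusBasis.repr.norm_map φ]
  have := lp.norm_rpow_eq_tsum (p := 2) (by norm_num) (torusBasis.repr φ)
  simp only [ENNReal.toReal_ofNat, Real.rpow_ofNat] at this
  rw [this]
  simp_rw [torusBasis_repr]

lemma hasSum_inner_fc (φ χ : L2Torus) :
    HasSum (fun n => starRingEnd ℂ (fc φ n) * fc χ n) (inner ℂ φ χ) := by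
  rw [← torusBasis.repr.inner_map_map φ χ]
  refine (lp.hasSum_inner (torusBasis.repr φ) (torusBasis.repr χ)).congr_fun fun n => ?_
  rw [torusBasis_repr, torusBasis_repr, RCLike.inner_apply, mul_comm]

lemma inner_eq_tsum_fc (φ χ : L2Torus) :
    inner ℂ φ χ = ∑' n, starRingEnd ℂ (fc φ n) * fc χ n := (hasSum_inner_fc φ χ).tsum_eq.symm

open Classical in
/-- The element of `L²(𝕋²)` with prescribed Fourier coefficients; it is `0` unless these are
square summable. -/
def ofCoeff (c : Freq → ℂ) : L2Torus :=
  if h : Memℓp c 2 then torusBasis.repr.symm ⟨c, h⟩ else 0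

lemma fc_ofCoeff {c : Freq → ℂ} (h : Memℓp c 2) (n : Freq) : fc (ofCoeff c) n = c n := by
  rw [ofCoeff, dif_pos h, ← torusBasis_repr]
  simp

lemma hasSum_ofCoeff {c : Freq → ℂ} (h : Memℓp c 2) :
    HasSum (fun n => c n • basisVec n) (ofCoeff c) := by
  have := torusBasis.hasSum_repr (ofCoeff c)
  simpa only [torusBasis_repr, fc_ofCoeff h, torusBasis_apply] using this

/-- The operator `e_m ↦ F(m) e_{m + P}` on `L²(𝕋²)` (for bounded `F`). -/
def wshift (P : Freq) (F : Freq → ℂ) (φ : L2Torus) : L2Torus :=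
  ofCoeff fun n => F (n - P) * fc φ (n - P)

lemma memℓp_wshift (P : Freq) {F : Freq → ℂ} {C : ℝ} (hF : ∀ m, ‖F m‖ ≤ C) (φ : L2Torus) :
    Memℓp (fun n => F (n - P) * fc φ (n - P)) 2 := by
  rw [memℓp_gen_iff (by norm_num)]
  simp only [ENNReal.toReal_ofNat, Real.rpow_ofNat]
  have h1 : Summable fun m => ‖F m * fc φ m‖ ^ 2 := by
    refine Summable.of_nonneg_of_le (fun _ => by positivity) (fun m => ?_)
      ((summable_sq_fc φ).mul_left (C ^ 2))
    rw [norm_mul, mul_pow]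
    gcongr
    exact hF m
  exact (Equiv.subRight P).summable_iff.2 h1

lemma fc_wshift (P : Freq) {F : Freq → ℂ} {C : ℝ} (hF : ∀ m, ‖F m‖ ≤ C) (φ : L2Torus)
    (n : Freq) : fc (wshift P F φ) n = F (n - P) * fc φ (n - P) :=
  fc_ofCoeff (memℓp_wshift P hF φ) n

lemma norm_sq_wshift (P : Freq) {F : Freq → ℂ} {C : ℝ} (hF : ∀ m, ‖F m‖ ≤ C) (φ : L2Torus) :
    ‖wshift P F φ‖ ^ 2 = ∑' m, ‖F m * fc φ m‖ ^ 2 := by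
  rw [norm_sq_eq_tsum]
  simp_rw [fc_wshift P hF]
  exact (Equiv.subRight P).tsum_eq fun m => ‖F m * fc φ m‖ ^ 2

lemma norm_wshift_le (P : Freq) {F : Freq → ℂ} {C : ℝ} (hF : ∀ m, ‖F m‖ ≤ C)
    (φ : L2Torus) : ‖wshift P F φ‖ ≤ C * ‖φ‖ := by
  have hC : 0 ≤ C := (norm_nonneg _).trans (hF 0)
  have h1 : ‖wshift P F φ‖ ^ 2 ≤ (C * ‖φ‖) ^ 2 := by
    rw [norm_sq_wshift P hF, mul_pow, norm_sq_eq_tsum, ← tsum_mul_left]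
    have hle : ∀ m, ‖F m * fc φ m‖ ^ 2 ≤ C ^ 2 * ‖fc φ m‖ ^ 2 := fun m => by
      rw [norm_mul, mul_pow]
      gcongr
      exact hF m
    have hs := (summable_sq_fc φ).mul_left (C ^ 2)
    exact (Summable.of_nonneg_of_le (fun _ => by positivity) hle hs).tsum_le_tsum hle hs
  exact le_of_sq_le_sq h1 (by positivity)

lemma wshift_sub (P : Freq) {F G : Freq → ℂ} {C D : ℝ} (hF : ∀ m, ‖F m‖ ≤ C)
    (hG : ∀ m, ‖G m‖ ≤ D) (φ : L2Torus) :
    wshift P F φ - wshift P G φ = wshift P (fun m => F m - G m) φ := by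
  have hFG : ∀ m, ‖F m - G m‖ ≤ C + D := fun m => (norm_sub_le _ _).trans (by
    gcongr
    exacts [hF m, hG m])
  apply ext_fc
  intro n
  rw [fc_sub, fc_wshift P hF, fc_wshift P hG, fc_wshift P hFG]
  ring

/-! ### The spectral projector -/

lemma norm_indicator_one_le (s : Set Freq) (m : Freq) :
    ‖s.indicator (fun _ => (1 : ℂ)) m‖ ≤ 1 := by
  by_cases h : m ∈ s <;> simp [h]

lemma spectralProjector_eq (h : ℝ) (S : Set ℝ) (φ : L2Torus) :
    spectralProjector h S φ
      = wshift 0 (Set.indicator {m | laplaceEigenvalue h m ∈ S} fun _ => 1) φ := by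
  have hb := norm_indicator_one_le {m | laplaceEigenvalue h m ∈ S}
  have := (hasSum_ofCoeff (memℓp_wshift 0 hb φ)).tsum_eq
  rw [wshift, ← this, spectralProjector]
  congr 1
  ext1 n
  by_cases hn : laplaceEigenvalue h n ∈ S <;> simp [Set.indicator, hn, fc, basisVec]

/-- A weighted shift whose weight is small off a set `A` of frequencies is small, up to the mass
carried by `A`. -/
lemma norm_wshift_le_of_small_off (P : Freq) {F : Freq → ℂ} {C η : ℝ} (A : Set Freq) (hη : 0 ≤ η)
    (hF : ∀ m, ‖F m‖ ≤ C) (hsmall : ∀ m ∉ A, ‖F m‖ ≤ η) (φ : L2Torus) :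
    ‖wshift P F φ‖ ≤ η * ‖φ‖ + C * ‖wshift 0 (A.indicator fun _ => 1) φ‖ := by
  have hC : 0 ≤ C := (norm_nonneg _).trans (hF 0)
  have hb := norm_indicator_one_le A
  have h1 : ‖wshift P F φ‖ ^ 2
      ≤ η ^ 2 * ‖φ‖ ^ 2 + C ^ 2 * ‖wshift 0 (A.indicator fun _ => 1) φ‖ ^ 2 := by
    rw [norm_sq_wshift P hF, norm_sq_wshift 0 hb, norm_sq_eq_tsum φ, ← tsum_mul_left,
      ← tsum_mul_left]
    have hs1 := (summable_sq_fc φ).mul_left (η ^ 2)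
    have hs2 : Summable fun m : Freq =>
        C ^ 2 * ‖A.indicator (fun _ => (1 : ℂ)) m * fc φ m‖ ^ 2 := by
      refine Summable.mul_left _ (Summable.of_nonneg_of_le (fun _ => by positivity)
        (fun m => ?_) (summable_sq_fc φ))
      rw [norm_mul, mul_pow]
      exact mul_le_of_le_one_left (by positivity) (pow_le_one₀ (norm_nonneg _) (hb m))
    rw [← hs1.tsum_add hs2]
    have hle : ∀ m, ‖F m * fc φ m‖ ^ 2 ≤ η ^ 2 * ‖fc φ m‖ ^ 2 +
        C ^ 2 * ‖A.indicator (fun _ => (1 : ℂ)) m * fc φ m‖ ^ 2 := fun m => by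
      by_cases hm : m ∈ A
      · rw [Set.indicator_of_mem hm, one_mul, norm_mul, mul_pow]
        have : ‖F m‖ ^ 2 * ‖fc φ m‖ ^ 2 ≤ C ^ 2 * ‖fc φ m‖ ^ 2 := by
          gcongr
          exact hF m
        nlinarith [mul_nonneg (sq_nonneg η) (sq_nonneg ‖fc φ m‖)]
      · rw [Set.indicator_of_notMem hm, zero_mul, norm_zero, norm_mul, mul_pow]
        have : ‖F m‖ ^ 2 * ‖fc φ m‖ ^ 2 ≤ η ^ 2 * ‖fc φ m‖ ^ 2 := by
          gcongr
          exact hsmall m hm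
        simpa using this
    exact (Summable.of_nonneg_of_le (fun _ => by positivity) hle (hs1.add hs2)).tsum_le_tsum hle
      (hs1.add hs2)
  refine le_of_sq_le_sq ?_ (by positivity)
  have : 0 ≤ (η * ‖φ‖) * (C * ‖wshift 0 (A.indicator fun _ => 1) φ‖) := by positivity
  nlinarith

lemma norm_wshift_indicator_mono {A A' : Set Freq} (h : A ⊆ A') (φ : L2Torus) :
    ‖wshift 0 (A.indicator fun _ => 1) φ‖ ≤ ‖wshift 0 (A'.indicator fun _ => 1) φ‖ := by
  have := norm_wshift_le_of_small_off 0 A' le_rfl (norm_indicator_one_le A)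
    (fun m hm => by rw [Set.indicator_of_notMem fun hA => hm (h hA), norm_zero]) φ
  simpa using this

/-! ### Multiplication operators -/

instance : IsProbabilityMeasure torusMeasure := by unfold torusMeasure; infer_instance

/-- Multiplication by a continuous function, as a bounded operator on `L²(𝕋²)`. -/
def mulOp : C(Torus, ℂ) →L[ℂ] L2Torus →L[ℂ] L2Torus :=
  ((ContinuousLinearMap.mul ℂ ℂ).holderL torusMeasure ∞ 2 2).comp
    (ContinuousMap.toLp ∞ torusMeasure ℂ)

lemma norm_mulOp_le (W : C(Torus, ℂ)) (φ : L2Torus) : ‖mulOp W φ‖ ≤ ‖W‖ * ‖φ‖ := by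
  have h1 : ‖(ContinuousLinearMap.mul ℂ ℂ).holderL torusMeasure ∞ 2 2‖ ≤ 1 :=
    (ContinuousLinearMap.norm_holderL_le _).trans (ContinuousLinearMap.opNorm_mul_le ℂ ℂ)
  have h2 : ‖ContinuousMap.toLp (E := ℂ) ∞ torusMeasure ℂ‖ ≤ 1 := by
    simpa using ContinuousMap.toLp_norm_le (α := Torus) (E := ℂ) (p := ∞) (μ := torusMeasure)
      (𝕜 := ℂ)
  have h3 : ‖mulOp‖ ≤ 1 := (ContinuousLinearMap.opNorm_comp_le _ _).trans
    (mul_le_one₀ h1 (norm_nonneg _) h2)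
  calc ‖mulOp W φ‖ ≤ ‖mulOp‖ * ‖W‖ * ‖φ‖ := mulOp.le_opNorm₂ W φ
    _ ≤ 1 * ‖W‖ * ‖φ‖ := by gcongr
    _ = ‖W‖ * ‖φ‖ := by rw [one_mul]

lemma coeFn_mulOp (W : C(Torus, ℂ)) (φ : L2Torus) :
    mulOp W φ =ᵐ[torusMeasure] fun x => W x * φ x := by
  have h1 := ContinuousLinearMap.coeFn_holder (r := 2) (B := ContinuousLinearMap.mul ℂ ℂ)
    (ContinuousMap.toLp (E := ℂ) ∞ torusMeasure ℂ W) φ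
  have h2 := ContinuousMap.coeFn_toLp (p := ∞) (𝕜 := ℂ) torusMeasure W
  filter_upwards [h1, h2] with x hx1 hx2
  rw [← hx2]
  exact hx1

lemma inner_mulOp_left (W : C(Torus, ℂ)) (hW : ∀ x, starRingEnd ℂ (W x) = W x)
    (φ χ : L2Torus) : inner ℂ (mulOp W φ) χ = inner ℂ φ (mulOp W χ) := by
  rw [L2.inner_def, L2.inner_def]
  refine integral_congr_ae ?_
  filter_upwards [coeFn_mulOp W φ, coeFn_mulOp W χ] with x h1 h2
  simp only [h1, h2, RCLike.inner_apply, map_mul, hW]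
  ring

lemma fc_eq_integral (φ : L2Torus) (n : Freq) :
    fc φ n = ∫ x, UnitAddTorus.mFourier (-n) x * φ x ∂torusMeasure := rfl

lemma fc_mulOp (W : C(Torus, ℂ)) (φ : L2Torus) (n : Freq) :
    fc (mulOp W φ) n = ∫ x, UnitAddTorus.mFourier (-n) x * (W x * φ x) ∂torusMeasure := by
  rw [fc_eq_integral]
  refine integral_congr_ae ?_
  filter_upwards [coeFn_mulOp W φ] with x h1
  rw [h1]

lemma fc_mulOp_mFourier (p : Freq) (φ : L2Torus) (n : Freq) :
    fc (mulOp (UnitAddTorus.mFourier p) φ) n = fc φ (n - p) := by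
  rw [fc_mulOp, fc_eq_integral]
  congr 1
  ext1 x
  rw [← mul_assoc, ← UnitAddTorus.mFourier_add]
  congr 3
  abel

/-! ### The characters of the torus -/

lemma mFourier_proj (k : Freq) (y : Fin 2 → ℝ) :
    UnitAddTorus.mFourier k (proj y)
      = Complex.exp (2 * Real.pi * Complex.I * (k 0 * y 0 + k 1 * y 1)) := by
  simp only [UnitAddTorus.mFourier, proj, ContinuousMap.coe_mk, Fin.prod_univ_two,
    fourier_coe_apply]
  rw [← Complex.exp_add]
  congr 1
  push_cast
  ring

lemma mFourier_add_point (k : Freq) (x y : Torus) :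
    UnitAddTorus.mFourier k (x + y) = UnitAddTorus.mFourier k x * UnitAddTorus.mFourier k y := by
  simp only [UnitAddTorus.mFourier, ContinuousMap.coe_mk, Pi.add_apply, fourier_apply, smul_add,
    AddCircle.toCircle_add, Circle.coe_mul, Finset.prod_mul_distrib]

lemma norm_mFourier_apply (k : Freq) (x : Torus) : ‖UnitAddTorus.mFourier k x‖ = 1 := by
  simp only [UnitAddTorus.mFourier, ContinuousMap.coe_mk, fourier_apply, norm_prod,
    Circle.norm_coe, Finset.prod_const_one]

lemma contDiff_mFourier_proj (k : Freq) :
    ContDiff ℝ ∞ fun y : Fin 2 → ℝ => UnitAddTorus.mFourier k (proj y) := by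
  simp_rw [mFourier_proj]
  refine ContDiff.cexp (contDiff_const.mul (ContDiff.add (contDiff_const.mul ?_)
    (contDiff_const.mul ?_)))
  · exact Complex.ofRealCLM.contDiff.comp (contDiff_apply ℝ ℝ (0 : Fin 2))
  · exact Complex.ofRealCLM.contDiff.comp (contDiff_apply ℝ ℝ (1 : Fin 2))

lemma torusPartial_mFourier (c : ℂ) (k : Freq) (j : Fin 2) :
    torusPartial j (fun x => c * UnitAddTorus.mFourier k x)
      = fun x => (c * (2 * Real.pi * Complex.I * k j)) * UnitAddTorus.mFourier k x := by
  ext x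
  have h1 : ∀ s : ℝ, c * UnitAddTorus.mFourier k (x + proj (Pi.single j s))
      = c * UnitAddTorus.mFourier k x * Complex.exp ((2 * Real.pi * Complex.I * k j) * s) := by
    intro s
    have h0 : (k 0 : ℂ) * ((Pi.single j s : Fin 2 → ℝ) 0 : ℂ)
        + k 1 * ((Pi.single j s : Fin 2 → ℝ) 1 : ℂ) = k j * s := by
      fin_cases j <;> simp
    rw [mFourier_add_point, mFourier_proj, h0]
    ring_nf
  have h2 : HasDerivAt (fun s : ℝ => Complex.exp ((2 * Real.pi * Complex.I * k j) * s))
      (2 * Real.pi * Complex.I * k j) 0 := by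
    have := ((Complex.ofRealCLM.hasDerivAt (x := 0)).const_mul
      (2 * Real.pi * Complex.I * k j : ℂ)).cexp
    simpa using this
  rw [torusPartial]
  simp_rw [h1]
  rw [(h2.const_mul _).deriv]
  ring

/-- The squared Euclidean norm `|k|²` of a lattice vector. -/
def freqSq (k : Freq) : ℝ := (k 0 : ℝ) ^ 2 + (k 1 : ℝ) ^ 2

lemma torusLaplacian_mFourier (k : Freq) (x : Torus) :
    torusLaplacian (UnitAddTorus.mFourier k) x
      = -(4 * Real.pi ^ 2 * freqSq k : ℝ) * UnitAddTorus.mFourier k x := by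
  have h := fun j => torusPartial_mFourier 1 k j
  simp only [one_mul] at h
  rw [torusLaplacian]
  have h' : ∀ j, torusPartial j (torusPartial j (UnitAddTorus.mFourier k)) x
      = ((2 * Real.pi * Complex.I * k j) * (2 * Real.pi * Complex.I * k j))
        * UnitAddTorus.mFourier k x := by
    intro j
    rw [h j, torusPartial_mFourier]
  simp_rw [h', Fin.sum_univ_two, freqSq]
  push_cast
  linear_combination (4 * Real.pi ^ 2 * ((k 0 : ℂ) ^ 2 + (k 1 : ℂ) ^ 2)
    * UnitAddTorus.mFourier k x) * Complex.I_sq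

/-! ### The free flow -/

/-- The phase factor `exp(- i θ |m|² / 2)` of the free evolution. -/
def freePhase (θ : ℝ) (m : Freq) : ℂ := Complex.exp (((-(θ * freqSq m / 2) : ℝ) : ℂ) * Complex.I)

lemma norm_freePhase (θ : ℝ) (m : Freq) : ‖freePhase θ m‖ = 1 := Complex.norm_exp_ofReal_mul_I _

lemma freePhase_neg_mul (θ : ℝ) (m : Freq) : freePhase (-θ) m * freePhase θ m = 1 := by
  rw [freePhase, freePhase, ← Complex.exp_add, Complex.exp_eq_one_iff]
  exact ⟨0, by push_cast; ring⟩

lemma conj_freePhase (θ : ℝ) (m : Freq) : starRingEnd ℂ (freePhase θ m) = freePhase (-θ) m := by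
  rw [freePhase, freePhase, ← Complex.exp_conj]
  congr 1
  simp only [map_mul, Complex.conj_ofReal, Complex.conj_I]
  push_cast
  ring

/-- The free Schrödinger group, parametrized so that `e_m` is multiplied by
`exp(- i θ |m|² / 2)`. -/
def freeFlow (θ : ℝ) : L2Torus →ₗᵢ[ℂ] L2Torus where
  toFun := wshift 0 (freePhase θ)
  map_add' φ χ := by
    apply ext_fc
    intro n
    simp only [fc_add, fc_wshift 0 (fun m => (norm_freePhase θ m).le)]
    ring
  map_smul' c φ := by
    apply ext_fc
    intro n
    simp only [fc_smul, fc_wshift 0 (fun m => (norm_freePhase θ m).le), RingHom.id_apply]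
    ring
  norm_map' φ := by
    have h : ‖wshift 0 (freePhase θ) φ‖ ^ 2 = ‖φ‖ ^ 2 := by
      rw [norm_sq_wshift 0 (fun m => (norm_freePhase θ m).le), norm_sq_eq_tsum]
      simp [norm_freePhase]
    exact (sq_eq_sq₀ (norm_nonneg _) (norm_nonneg _)).1 h

lemma fc_freeFlow (θ : ℝ) (φ : L2Torus) (n : Freq) :
    fc (freeFlow θ φ) n = freePhase θ n * fc φ n := by
  have := fc_wshift 0 (fun m => (norm_freePhase θ m).le) φ n
  rwa [sub_zero] at this

lemma freeFlow_neg_freeFlow (θ : ℝ) (φ : L2Torus) : freeFlow (-θ) (freeFlow θ φ) = φ := by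
  apply ext_fc
  intro n
  rw [fc_freeFlow, fc_freeFlow, ← mul_assoc, freePhase_neg_mul, one_mul]

lemma freeFlow_freeFlow_neg (θ : ℝ) (φ : L2Torus) : freeFlow θ (freeFlow (-θ) φ) = φ := by
  simpa using freeFlow_neg_freeFlow (-θ) φ

lemma freeFlow_zero (φ : L2Torus) : freeFlow 0 φ = φ := by
  apply ext_fc
  intro n
  simp [fc_freeFlow, freePhase]

lemma inner_freeFlow_left (θ : ℝ) (φ χ : L2Torus) :
    inner ℂ (freeFlow θ φ) χ = inner ℂ φ (freeFlow (-θ) χ) := by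
  rw [inner_eq_tsum_fc, inner_eq_tsum_fc]
  congr 1
  ext n
  rw [fc_freeFlow, fc_freeFlow, map_mul, conj_freePhase]
  ring

/-- Strong continuity of the free Schrödinger group. -/
lemma continuous_freeFlow (φ : L2Torus) : Continuous fun θ => freeFlow θ φ := by
  rw [continuous_iff_continuousAt]
  intro θ₀
  rw [ContinuousAt, tendsto_iff_norm_sub_tendsto_zero]
  have h1 : Tendsto (fun θ => ‖freeFlow θ φ - freeFlow θ₀ φ‖ ^ 2) (𝓝 θ₀) (𝓝 0) := by
    simp_rw [norm_sq_eq_tsum, fc_sub, fc_freeFlow, ← sub_mul, norm_mul, mul_pow]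
    have h0 : (0 : ℝ) = ∑' n : Freq, (0 : ℝ) := by simp
    rw [h0]
    refine tendsto_tsum_of_dominated_convergence (bound := fun n => 4 * ‖fc φ n‖ ^ 2)
      ((summable_sq_fc φ).mul_left 4) (fun n => ?_) (Eventually.of_forall fun θ n => ?_)
    · have hc : Continuous fun θ => ‖freePhase θ n - freePhase θ₀ n‖ ^ 2 * ‖fc φ n‖ ^ 2 := by
        unfold freePhase
        fun_prop
      have := hc.tendsto θ₀
      simpa using this
    · have : ‖freePhase θ n - freePhase θ₀ n‖ ≤ 2 := by
        refine (norm_sub_le _ _).trans ?_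
        rw [norm_freePhase, norm_freePhase]
        norm_num
      rw [Real.norm_of_nonneg (by positivity)]
      have h4 : ‖freePhase θ n - freePhase θ₀ n‖ ^ 2 ≤ 4 := by
        nlinarith [norm_nonneg (freePhase θ n - freePhase θ₀ n)]
      gcongr
  have h2 := h1.sqrt
  simpa [Real.sqrt_sq (norm_nonneg _)] using h2

lemma continuous_freeFlow_comp {g : ℝ → ℝ} {f : ℝ → L2Torus} (hg : Continuous g)
    (hf : Continuous f) : Continuous fun t => freeFlow (g t) (f t) := by
  rw [continuous_iff_continuousAt]
  intro t₀
  have h1 : Tendsto (fun t => freeFlow (g t) (f t₀)) (𝓝 t₀) (𝓝 (freeFlow (g t₀) (f t₀))) :=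
    ((continuous_freeFlow (f t₀)).comp hg).tendsto t₀
  have h2 : Tendsto (fun t => freeFlow (g t) (f t - f t₀)) (𝓝 t₀) (𝓝 0) := by
    rw [tendsto_zero_iff_norm_tendsto_zero]
    simp_rw [LinearIsometry.norm_map]
    have := (hf.sub (continuous_const (y := f t₀))).norm.tendsto t₀
    simpa using this
  have := h1.add h2
  rw [add_zero] at this
  refine this.congr fun t => ?_
  rw [← map_add, add_sub_cancel]

/-- The multiplication operator `W` conjugated by the free flow. -/
def heisenberg (κ : ℝ) (W : C(Torus, ℂ)) (r : ℝ) : L2Torus →L[ℂ] L2Torus :=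
  (freeFlow (-(κ * r))).toContinuousLinearMap.comp
    ((mulOp W).comp (freeFlow (κ * r)).toContinuousLinearMap)

lemma heisenberg_apply (κ : ℝ) (W : C(Torus, ℂ)) (r : ℝ) (φ : L2Torus) :
    heisenberg κ W r φ = freeFlow (-(κ * r)) (mulOp W (freeFlow (κ * r) φ)) := rfl

lemma norm_heisenberg_le (κ : ℝ) (W : C(Torus, ℂ)) (r : ℝ) (φ : L2Torus) :
    ‖heisenberg κ W r φ‖ ≤ ‖W‖ * ‖φ‖ := by
  rw [heisenberg_apply, LinearIsometry.norm_map]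
  exact (norm_mulOp_le _ _).trans_eq (by rw [LinearIsometry.norm_map])

lemma heisenberg_sub (κ : ℝ) (W Z : C(Torus, ℂ)) (r : ℝ) (φ : L2Torus) :
    heisenberg κ W r φ - heisenberg κ Z r φ = heisenberg κ (W - Z) r φ := by
  simp [heisenberg_apply]

lemma inner_heisenberg_left (κ : ℝ) {W : C(Torus, ℂ)} (hW : ∀ x, starRingEnd ℂ (W x) = W x)
    (r : ℝ) (φ χ : L2Torus) :
    inner ℂ (heisenberg κ W r φ) χ = inner ℂ φ (heisenberg κ W r χ) := by
  rw [heisenberg_apply, heisenberg_apply, inner_freeFlow_left, neg_neg, inner_mulOp_left W hW,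
    inner_freeFlow_left]

lemma continuous_heisenberg (κ : ℝ) (W : C(Torus, ℂ)) {f : ℝ → L2Torus} (hf : Continuous f) :
    Continuous fun r => heisenberg κ W r (f r) := by
  simp_rw [heisenberg_apply]
  refine continuous_freeFlow_comp (by fun_prop) ((mulOp W).continuous.comp ?_)
  exact continuous_freeFlow_comp (by fun_prop) hf

/-! ### The interaction picture -/

lemma fc_intervalIntegral {f : ℝ → L2Torus} (hf : Continuous f) (a b : ℝ) (n : Freq) :
    fc (∫ r in a..b, f r) n = ∫ r in a..b, fc (f r) n := by
  simp_rw [fc_eq_inner]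
  exact ((innerSL ℂ (basisVec n)).intervalIntegral_comp_comm
    (hf.intervalIntegrable a b)).symm

/-- A path whose Fourier coefficients are differentiable, with derivatives the coefficients of a
continuous path, is differentiable in `L²(𝕋²)`. -/
lemma hasDerivAt_of_fc {w b : ℝ → L2Torus} (hb : Continuous b)
    (h : ∀ n t, HasDerivAt (fun s => fc (w s) n) (fc (b t) n) t) (t : ℝ) :
    HasDerivAt w (b t) t := by
  have hW : ∀ t, HasDerivAt (fun s => w 0 + ∫ r in (0 : ℝ)..s, b r) (b t) t := fun t =>
    (hb.integral_hasStrictDerivAt 0 t).hasDerivAt.const_add _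
  have heq : w = fun s => w 0 + ∫ r in (0 : ℝ)..s, b r := by
    ext1 s
    apply ext_fc
    intro n
    have hfc : ∀ t, HasDerivAt (fun s => fc (w 0 + ∫ r in (0 : ℝ)..s, b r) n) (fc (b t) n) t := by
      intro t
      simp_rw [fc_eq_inner]
      simpa using (hasDerivAt_const t (basisVec n)).inner ℂ (hW t)
    have hc := is_const_of_deriv_eq_zero
      (f := fun s => fc (w s) n - fc (w 0 + ∫ r in (0 : ℝ)..s, b r) n)
      (fun t => ((h n t).sub (hfc t)).differentiableAt)
      (fun t => ((h n t).sub (hfc t)).deriv.trans (sub_self _)) s 0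
    simp only [intervalIntegral.integral_same, add_zero, sub_self] at hc
    exact sub_eq_zero.1 hc
  rw [heq]
  exact hW t

lemma IsSchrodingerSolution.hasDerivAt_fc {h : ℝ} (hh : h ≠ 0) {W : Torus → ℝ} {Z : C(Torus, ℂ)}
    (hZ : ∀ x, Z x = W x) {ψ : L2Torus} {u : ℝ → L2Torus} (hu : IsSchrodingerSolution h W ψ u)
    (n : Freq) (t : ℝ) :
    HasDerivAt (fun s => fc (u s) n)
      ((Complex.I * h)⁻¹ * (((h ^ 2 / 2 * (4 * Real.pi ^ 2 * freqSq n) : ℝ) : ℂ) * fc (u t) n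
        + fc (mulOp Z (u t)) n)) t := by
  have hI : Complex.I * (h : ℂ) ≠ 0 := mul_ne_zero Complex.I_ne_zero (by exact_mod_cast hh)
  have h1 := (hu.equation (UnitAddTorus.mFourier (-n)) (contDiff_mFourier_proj (-n)) t).const_mul
    (Complex.I * (h : ℂ))⁻¹
  have h2 : (fun s => (Complex.I * (h : ℂ))⁻¹ * (Complex.I * (h : ℂ) *
      ∫ x, UnitAddTorus.mFourier (-n) x * u s x ∂torusMeasure)) = fun s => fc (u s) n := by
    ext s
    rw [inv_mul_cancel_left₀ hI, fc_eq_integral]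
  rw [h2] at h1
  refine h1.congr_deriv (congrArg _ (Eq.symm ?_))
  rw [fc_mulOp, fc_eq_integral, ← integral_const_mul, ← integral_add]
  · congr 1
    ext1 x
    rw [torusLaplacian_mFourier, hZ]
    have : freqSq (-n) = freqSq n := by simp [freqSq]
    rw [this]
    push_cast
    ring
  · have hi := (L2.integrable_inner (𝕜 := ℂ) (basisVec n) (u t)).const_mul
      ((h ^ 2 / 2 * (4 * Real.pi ^ 2 * freqSq n) : ℝ) : ℂ)
    refine hi.congr ?_
    filter_upwards [UnitAddTorus.coeFn_mFourierLp 2 n] with x hx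
    have hx' : basisVec n x = UnitAddTorus.mFourier n x := hx
    rw [RCLike.inner_apply, hx', UnitAddTorus.mFourier_neg, mul_comm (u t x)]
  · have hi := L2.integrable_inner (𝕜 := ℂ) (basisVec n) (mulOp Z (u t))
    refine hi.congr ?_
    filter_upwards [UnitAddTorus.coeFn_mFourierLp 2 n, coeFn_mulOp Z (u t)] with x hx hx2
    have hx' : basisVec n x = UnitAddTorus.mFourier n x := hx
    rw [RCLike.inner_apply, hx', hx2, UnitAddTorus.mFourier_neg, mul_comm]

/-- In the time scale `t ħ / ε`, the solution seen in the interaction picture solves an evolution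
equation whose generator is bounded uniformly in the semiclassical parameter. -/
lemma IsSchrodingerSolution.hasDerivAt_interaction {h ε : ℝ} (hh : 0 < h) (hε : 0 < ε)
    {V : Torus → ℝ} {Z : C(Torus, ℂ)} (hZ : ∀ x, Z x = V x) {ψ : L2Torus} {u : ℝ → L2Torus}
    (hu : IsSchrodingerSolution h (fun x => ε * V x) ψ u) (t : ℝ) :
    HasDerivAt (fun s => freeFlow (-(4 * Real.pi ^ 2 * h ^ 2 / ε * s)) (u (s * (h / ε))))
      (-Complex.I • heisenberg (4 * Real.pi ^ 2 * h ^ 2 / ε) Z t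
        (freeFlow (-(4 * Real.pi ^ 2 * h ^ 2 / ε * t)) (u (t * (h / ε))))) t := by
  set κ := 4 * Real.pi ^ 2 * h ^ 2 / ε with hκ
  have huc : Continuous fun s : ℝ => u (s * (h / ε)) := hu.continuous.comp (by fun_prop)
  have hc : Continuous fun t : ℝ => heisenberg κ Z t (freeFlow (-(κ * t)) (u (t * (h / ε)))) :=
    continuous_heisenberg κ Z (continuous_freeFlow_comp (g := fun t => -(κ * t)) (by fun_prop) huc)
  have hbc : Continuous fun t : ℝ =>
      -Complex.I • heisenberg κ Z t (freeFlow (-(κ * t)) (u (t * (h / ε)))) :=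
    (continuous_const_smul (-Complex.I)).comp hc
  refine hasDerivAt_of_fc hbc (fun n t => ?_) t
  have hZ' : ∀ x, ((ε : ℂ) • Z) x = ((ε * V x : ℝ) : ℂ) := fun x => by simp [hZ]
  have h1 := (hu.hasDerivAt_fc hh.ne' hZ' n (t * (h / ε))).scomp t
    ((hasDerivAt_id t).mul_const (h / ε))
  have h2 : HasDerivAt (fun s : ℝ => freePhase (-(κ * s)) n)
      ((κ * freqSq n / 2 : ℝ) * Complex.I * freePhase (-(κ * t)) n) t := by
    have h3 : HasDerivAt (fun s : ℝ => ((-(-(κ * s) * freqSq n / 2) : ℝ) : ℂ) * Complex.I)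
        ((κ * freqSq n / 2 : ℝ) * Complex.I) t := by
      have h4 := ((hasDerivAt_id t).ofReal_comp).const_mul ((κ * freqSq n / 2 : ℝ) * Complex.I)
      simp only [Complex.ofReal_one, mul_one] at h4
      refine h4.congr_of_eventuallyEq (Eventually.of_forall fun s => ?_)
      simp only [id]
      push_cast
      ring
    have h5 := h3.cexp
    rw [mul_comm] at h5
    exact h5
  have h6 := h2.mul h1
  have hεc : (ε : ℂ) ≠ 0 := by exact_mod_cast hε.ne'
  have hhc : (h : ℂ) ≠ 0 := by exact_mod_cast hh.ne'
  simp only [fc_freeFlow, heisenberg_apply, freeFlow_freeFlow_neg, fc_smul]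
  refine h6.congr_deriv (Eq.symm ?_)
  · simp only [Function.comp_apply, id, map_smul, one_mul, smul_apply, fc_smul, Complex.real_smul]
    generalize freePhase (-(κ * t)) n = A
    generalize fc (mulOp Z (u (t * (h / ε)))) n = B
    generalize fc (u (t * (h / ε))) n = D
    rw [hκ]
    push_cast
    field_simp
    linear_combination (-2 * B * ε - 4 * Real.pi ^ 2 * h ^ 2 * freqSq n * D) * A * Complex.I_sq

/-! ### Time slicing of a bounded evolution equation -/

section Slicing

variable {H : Type*} [NormedAddCommGroup H] [InnerProductSpace ℂ H]

/-- The backward time-sliced evolution `φ ↦ φ + i ∫ B(r) φ dr` over the intervals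
`[s (k + 1), s k]`. -/
def backwardSlices (B : ℝ → H →L[ℂ] H) (s : ℕ → ℝ) (ψ : H) : ℕ → H
  | 0 => ψ
  | k + 1 => backwardSlices B s ψ k
      + Complex.I • ∫ r in s (k + 1)..s k, B r (backwardSlices B s ψ k)

lemma norm_eq_of_symmetric_evolution {B : ℝ → H →L[ℂ] H}
    (hB : ∀ r φ χ, inner ℂ (B r φ) χ = inner ℂ φ (B r χ)) {w : ℝ → H}
    (hw : ∀ t, HasDerivAt w (-Complex.I • B t (w t)) t) (t : ℝ) : ‖w t‖ = ‖w 0‖ := by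
  have h1 : ∀ t, HasDerivAt (fun s => inner ℂ (w s) (w s)) 0 t := fun t => by
    have := (hw t).inner ℂ (hw t)
    refine this.congr_deriv ?_
    rw [inner_smul_right, inner_smul_left, hB]
    simp
  have h2 := is_const_of_deriv_eq_zero (fun t => (h1 t).differentiableAt)
    (fun t => (h1 t).deriv) t 0
  rw [inner_self_eq_norm_sq_to_K, inner_self_eq_norm_sq_to_K] at h2
  have h3 : ‖w t‖ ^ 2 = ‖w 0‖ ^ 2 := by exact_mod_cast h2
  exact (sq_eq_sq₀ (norm_nonneg _) (norm_nonneg _)).1 h3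

lemma norm_evolution_sub_le {B : ℝ → H →L[ℂ] H} {C : ℝ} (hC : ∀ r φ, ‖B r φ‖ ≤ C * ‖φ‖)
    (hB : ∀ r φ χ, inner ℂ (B r φ) χ = inner ℂ φ (B r χ)) {w : ℝ → H}
    (hw : ∀ t, HasDerivAt w (-Complex.I • B t (w t)) t) (hw0 : ‖w 0‖ = 1) (a b : ℝ) :
    ‖w b - w a‖ ≤ C * |b - a| := by
  have := convex_univ.norm_image_sub_le_of_norm_hasDerivWithin_le (C := C)
    (fun x _ => (hw x).hasDerivWithinAt) (fun x _ => ?_) (Set.mem_univ a) (Set.mem_univ b)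
  · simpa using this
  · rw [norm_smul, norm_neg, Complex.norm_I, one_mul]
    refine (hC _ _).trans_eq ?_
    rw [norm_eq_of_symmetric_evolution hB hw, hw0, mul_one]

lemma norm_backwardSlices_le {B : ℝ → H →L[ℂ] H} {C Δ : ℝ} (hC0 : 0 ≤ C)
    (hC : ∀ r φ, ‖B r φ‖ ≤ C * ‖φ‖) {s : ℕ → ℝ} (hs : ∀ k, |s k - s (k + 1)| ≤ Δ) (ψ : H)
    (k : ℕ) : ‖backwardSlices B s ψ k‖ ≤ (1 + C * Δ) ^ k * ‖ψ‖ := by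
  have hΔ : 0 ≤ Δ := (abs_nonneg _).trans (hs 0)
  induction k with
  | zero => simp [backwardSlices]
  | succ k ih =>
    rw [backwardSlices]
    set φ := backwardSlices B s ψ k
    have h1 : ‖∫ r in s (k + 1)..s k, B r φ‖ ≤ C * ‖φ‖ * Δ :=
      (intervalIntegral.norm_integral_le_of_norm_le_const fun r _ => hC r φ).trans (by
        gcongr
        exact hs k)
    calc _ ≤ ‖φ‖ + C * ‖φ‖ * Δ := (norm_add_le _ _).trans (by
          rw [norm_smul, Complex.norm_I, one_mul]
          gcongr)
      _ = (1 + C * Δ) * ‖φ‖ := by ring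
      _ ≤ (1 + C * Δ) * ((1 + C * Δ) ^ k * ‖ψ‖) := by gcongr
      _ = _ := by ring

variable [CompleteSpace H]

lemma norm_inner_slice_sub_le {B B' : ℝ → H →L[ℂ] H} {C δ : ℝ}
    (hC : ∀ r φ, ‖B r φ‖ ≤ C * ‖φ‖) (hδ : ∀ r φ, ‖B r φ - B' r φ‖ ≤ δ * ‖φ‖)
    (hB : ∀ r φ χ, inner ℂ (B r φ) χ = inner ℂ φ (B r χ))
    (hB'c : ∀ φ, Continuous fun r => B' r φ) {w : ℝ → H}
    (hw : ∀ t, HasDerivAt w (-Complex.I • B t (w t)) t) (hw0 : ‖w 0‖ = 1) (a b : ℝ) (φ : H) :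
    ‖inner ℂ (w b) φ - inner ℂ (w a) (φ + Complex.I • ∫ r in a..b, B' r φ)‖
      ≤ (C ^ 2 * |b - a| + δ) * |b - a| * ‖φ‖ := by
  rcases eq_or_ne φ 0 with rfl | hφ
  · simp
  have hCpos : 0 ≤ C := nonneg_of_mul_nonneg_left ((norm_nonneg _).trans (hC 0 φ))
    (norm_pos_iff.2 hφ)
  set g : ℝ → ℂ := fun r => inner ℂ (w r) φ
    - inner ℂ (w a) (φ + Complex.I • ∫ r in a..r, B' r φ) with hg
  have hg' : ∀ r, HasDerivAt g (Complex.I * (inner ℂ (w r - w a) (B r φ)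
      + inner ℂ (w a) (B r φ - B' r φ))) r := by
    intro r
    have h1 := (hw r).inner ℂ (hasDerivAt_const r φ)
    have h2 := (hasDerivAt_const r (w a)).inner ℂ
      ((((hB'c φ).integral_hasStrictDerivAt a r).hasDerivAt.const_smul Complex.I).const_add φ)
    refine (h1.sub h2).congr_deriv ?_
    simp only [inner_zero_right, inner_smul_left, hB, inner_zero_left, inner_sub_left,
      inner_sub_right, inner_smul_right, map_neg, Complex.conj_I]
    ring
  have hbound : ∀ r ∈ Set.uIcc a b, ‖Complex.I * (inner ℂ (w r - w a) (B r φ)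
      + inner ℂ (w a) (B r φ - B' r φ))‖ ≤ (C ^ 2 * |b - a| + δ) * ‖φ‖ := by
    intro r hr
    have hra : |r - a| ≤ |b - a| := Set.abs_sub_left_of_mem_uIcc hr
    rw [norm_mul, Complex.norm_I, one_mul]
    calc _ ≤ ‖w r - w a‖ * ‖B r φ‖ + ‖w a‖ * ‖B r φ - B' r φ‖ :=
          (norm_add_le _ _).trans (add_le_add (norm_inner_le_norm _ _) (norm_inner_le_norm _ _))
      _ ≤ (C * |b - a|) * (C * ‖φ‖) + 1 * (δ * ‖φ‖) := by
          gcongr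
          · exact (norm_evolution_sub_le hC hB hw hw0 a r).trans (by gcongr)
          · exact hC _ _
          · rw [norm_eq_of_symmetric_evolution hB hw, hw0]
          · exact hδ _ _
      _ = (C ^ 2 * |b - a| + δ) * ‖φ‖ := by ring
  have := (convex_uIcc a b).norm_image_sub_le_of_norm_hasDerivWithin_le
    (fun x _ => (hg' x).hasDerivWithinAt) hbound Set.left_mem_uIcc Set.right_mem_uIcc
  have hga : g a = 0 := by simp [hg]
  rw [hga, sub_zero, Real.norm_eq_abs] at this
  calc _ = ‖g b‖ := rfl
    _ ≤ _ := this
    _ = _ := by ring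

/-- The time-sliced evolution of an approximate generator computes the overlaps of the exact
evolution, with an error controlled by operator norms only. -/
lemma norm_inner_sub_backwardSlices_le {B B' : ℝ → H →L[ℂ] H} {C δ Δ : ℝ} (hC0 : 0 ≤ C)
    (hδ0 : 0 ≤ δ) (hC : ∀ r φ, ‖B r φ‖ ≤ C * ‖φ‖) (hC' : ∀ r φ, ‖B' r φ‖ ≤ C * ‖φ‖)
    (hδ : ∀ r φ, ‖B r φ - B' r φ‖ ≤ δ * ‖φ‖)
    (hB : ∀ r φ χ, inner ℂ (B r φ) χ = inner ℂ φ (B r χ))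
    (hB'c : ∀ φ, Continuous fun r => B' r φ) {w : ℝ → H}
    (hw : ∀ t, HasDerivAt w (-Complex.I • B t (w t)) t) (hw0 : ‖w 0‖ = 1)
    {s : ℕ → ℝ} (hs : ∀ k, |s k - s (k + 1)| ≤ Δ) (ψ : H) (n : ℕ) :
    ‖inner ℂ (w (s 0)) ψ - inner ℂ (w (s n)) (backwardSlices B' s ψ n)‖
      ≤ n * ((C ^ 2 * Δ + δ) * Δ * ((1 + C * Δ) ^ n * ‖ψ‖)) := by
  have hΔ : 0 ≤ Δ := (abs_nonneg _).trans (hs 0)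
  have key : ∀ k ≤ n, ‖inner ℂ (w (s 0)) ψ - inner ℂ (w (s k)) (backwardSlices B' s ψ k)‖
      ≤ k * ((C ^ 2 * Δ + δ) * Δ * ((1 + C * Δ) ^ n * ‖ψ‖)) := by
    intro k
    induction k with
    | zero => simp [backwardSlices]
    | succ k ih =>
      intro hk
      have h1 := ih (by omega)
      have h2 := norm_inner_slice_sub_le hC hδ hB hB'c hw hw0 (s (k + 1)) (s k)
        (backwardSlices B' s ψ k)
      have h3 : ‖backwardSlices B' s ψ k‖ ≤ (1 + C * Δ) ^ n * ‖ψ‖ := by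
        refine (norm_backwardSlices_le hC0 hC' hs ψ k).trans ?_
        gcongr
        · linarith [mul_nonneg hC0 hΔ]
        · omega
      have h4 : (C ^ 2 * |s k - s (k + 1)| + δ) * |s k - s (k + 1)| * ‖backwardSlices B' s ψ k‖
          ≤ (C ^ 2 * Δ + δ) * Δ * ((1 + C * Δ) ^ n * ‖ψ‖) := by
        gcongr <;> exact hs k
      have h5 := norm_sub_le_norm_sub_add_norm_sub (inner ℂ (w (s 0)) ψ)
        (inner ℂ (w (s k)) (backwardSlices B' s ψ k))
        (inner ℂ (w (s (k + 1))) (backwardSlices B' s ψ (k + 1)))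
      rw [backwardSlices] at h5 ⊢
      push_cast
      linarith
  exact key n le_rfl

end Slicing

/-! ### Oscillatory integrals -/

/-- The oscillatory integral `∫_a^b exp(i r θ) dr`. -/
def oscInt (a b θ : ℝ) : ℂ := ∫ r in a..b, Complex.exp (((r * θ : ℝ) : ℂ) * Complex.I)

lemma norm_oscInt_le (a b θ : ℝ) : ‖oscInt a b θ‖ ≤ |b - a| := by
  have := intervalIntegral.norm_integral_le_of_norm_le_const (a := a) (b := b) (C := 1)
    (f := fun r : ℝ => Complex.exp (((r * θ : ℝ) : ℂ) * Complex.I))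
    fun r _ => (Complex.norm_exp_ofReal_mul_I _).le
  simpa [oscInt] using this

lemma norm_oscInt_sub_le (a b θ θ' : ℝ) :
    ‖oscInt a b θ - oscInt a b θ'‖ ≤ (|a| + |b|) * |θ - θ'| * |b - a| := by
  rw [oscInt, oscInt, ← intervalIntegral.integral_sub]
  · refine intervalIntegral.norm_integral_le_of_norm_le_const fun r hr => ?_
    have h1 : |r| ≤ |a| + |b| := by
      rcases Set.mem_uIoc.1 hr with h | h <;> rw [abs_le] <;>
        constructor <;> linarith [neg_abs_le a, neg_abs_le b, le_abs_self a, le_abs_self b,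
          abs_nonneg a, abs_nonneg b]
    have h2 : ‖Complex.exp (((r * θ : ℝ) : ℂ) * Complex.I)
        - Complex.exp (((r * θ' : ℝ) : ℂ) * Complex.I)‖ ≤ |r * θ - r * θ'| := by
      have h3 : Complex.exp (((r * θ : ℝ) : ℂ) * Complex.I)
          - Complex.exp (((r * θ' : ℝ) : ℂ) * Complex.I)
          = Complex.exp (((r * θ' : ℝ) : ℂ) * Complex.I)
            * (Complex.exp (Complex.I * ((r * θ - r * θ' : ℝ) : ℂ)) - 1) := by
        rw [mul_sub, ← Complex.exp_add, mul_one]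
        congr 2
        push_cast
        ring
      rw [h3, norm_mul, Complex.norm_exp_ofReal_mul_I, one_mul]
      exact Real.norm_exp_I_mul_ofReal_sub_one_le
    refine h2.trans ?_
    rw [← mul_sub, abs_mul]
    gcongr
  · exact Continuous.intervalIntegrable (by fun_prop) _ _
  · exact Continuous.intervalIntegrable (by fun_prop) _ _

lemma oscInt_zero (a b : ℝ) : oscInt a b 0 = (b - a : ℝ) := by
  simp [oscInt]

lemma continuous_oscInt (a b : ℝ) : Continuous (oscInt a b) := by
  unfold oscInt
  exact intervalIntegral.continuous_parametric_intervalIntegral_of_continuous' (by fun_prop) a b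

lemma norm_oscInt_le_two_div (a b : ℝ) {θ : ℝ} (hθ : θ ≠ 0) : ‖oscInt a b θ‖ ≤ 2 / |θ| := by
  have hc : (θ : ℂ) * Complex.I ≠ 0 := mul_ne_zero (by exact_mod_cast hθ) Complex.I_ne_zero
  have h1 : oscInt a b θ = (Complex.exp (((b * θ : ℝ) : ℂ) * Complex.I)
      - Complex.exp (((a * θ : ℝ) : ℂ) * Complex.I)) / (θ * Complex.I) := by
    have := integral_exp_mul_complex (a := a) (b := b) hc
    rw [oscInt]
    convert this using 3
    all_goals push_cast
    all_goals try ring_nf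
  rw [h1, norm_div, norm_mul, Complex.norm_I, mul_one, Complex.norm_real, Real.norm_eq_abs]
  gcongr
  refine (norm_sub_le _ _).trans ?_
  rw [Complex.norm_exp_ofReal_mul_I, Complex.norm_exp_ofReal_mul_I]
  norm_num

lemma contDiff_setIntegral_exp (a b : ℝ) : ContDiff ℝ ∞ fun θ : ℝ =>
    ∫ r in Set.Ioc a b, Complex.exp (((r * θ : ℝ) : ℂ) * Complex.I) := by
  have h := VectorFourier.contDiff_fourierIntegral (μ := volume.restrict (Set.Ioc a b))
    (f := fun _ : ℝ => (1 : ℂ)) (N := ⊤) (-(2 * Real.pi)⁻¹ • ContinuousLinearMap.mul ℝ ℝ)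
    fun n _ => by
      have hc : Continuous fun v : ℝ => ‖v‖ ^ n * ‖(1 : ℂ)‖ := by fun_prop
      exact (hc.integrableOn_Icc (a := a) (b := b)).mono_set Set.Ioc_subset_Icc_self
  refine Eq.subst (motive := ContDiff ℝ ∞) (funext fun θ => Eq.symm ?_) h
  change _ = ∫ r in Set.Ioc a b,
    Real.fourierChar (-((-(2 * Real.pi)⁻¹ • ContinuousLinearMap.mul ℝ ℝ) r θ)) • (1 : ℂ)
  congr 1
  ext1 r
  rw [Circle.smul_def, Real.fourierChar_apply, smul_eq_mul, mul_one]
  congr 1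
  simp only [smul_apply, ContinuousLinearMap.mul_apply', smul_eq_mul]
  push_cast
  have : (Real.pi : ℂ) ≠ 0 := by exact_mod_cast Real.pi_ne_zero
  field_simp

lemma contDiff_oscInt (a b : ℝ) : ContDiff ℝ ∞ (oscInt a b) :=
  (contDiff_setIntegral_exp a b).sub (contDiff_setIntegral_exp b a)

/-! ### Primitive sublattices of rank one -/

/-- The determinant of two lattice vectors. -/
def latticeDet (p k : Freq) : ℤ := p 0 * k 1 - p 1 * k 0

/-- The Euclidean inner product of two lattice vectors, as a real number. -/
def freqDot (m p : Freq) : ℝ := m 0 * p 0 + m 1 * p 1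

lemma freqDot_add_left (m n p : Freq) : freqDot (m + n) p = freqDot m p + freqDot n p := by
  simp [freqDot]
  ring

lemma exists_smul_of_latticeDet_eq_zero {p k : Freq} (hp : p ≠ 0) (h : latticeDet p k = 0) :
    ∃ c : ℝ, (fun i => (k i : ℝ)) = c • fun i => (p i : ℝ) := by
  have hR : (p 0 : ℝ) * k 1 - p 1 * k 0 = 0 := by exact_mod_cast h
  by_cases h0 : p 0 = 0
  · have h1 : p 1 ≠ 0 := fun h1 => hp (by ext i; fin_cases i <;> simpa)
    have h1' : (p 1 : ℝ) ≠ 0 := by exact_mod_cast h1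
    refine ⟨k 1 / p 1, ?_⟩
    ext i
    fin_cases i
    · simp only [Fin.zero_eta, Pi.smul_apply, smul_eq_mul]
      field_simp
      linarith
    · simp only [Fin.mk_one, Pi.smul_apply, smul_eq_mul]
      field_simp
  · have h0' : (p 0 : ℝ) ≠ 0 := by exact_mod_cast h0
    refine ⟨k 0 / p 0, ?_⟩
    ext i
    fin_cases i
    · simp only [Fin.zero_eta, Pi.smul_apply, smul_eq_mul]
      field_simp
    · simp only [Fin.mk_one, Pi.smul_apply, smul_eq_mul]
      field_simp
      linarith

lemma latticeDet_eq_zero_of_smul {p k : Freq} {c : ℝ}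
    (h : (fun i => (k i : ℝ)) = c • fun i => (p i : ℝ)) : latticeDet p k = 0 := by
  have h0 : (k 0 : ℝ) = c * p 0 := congrFun h 0
  have h1 : (k 1 : ℝ) = c * p 1 := congrFun h 1
  have : (p 0 : ℝ) * k 1 - p 1 * k 0 = 0 := by
    rw [h0, h1]
    ring
  exact_mod_cast this

lemma intCast_ne_zero {p : Freq} (hp : p ≠ 0) : (fun i => (p i : ℝ)) ≠ 0 := by
  intro h
  apply hp
  ext i
  have := congrFun h i
  simpa using this

/-- A primitive sublattice of rank one is determined by any of its nonzero vectors. -/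
lemma mem_lattice_iff (Λ : PrimitiveLattice) {p : Freq} (hp : p ∈ Λ.1) (hp0 : p ≠ 0) (k : Freq) :
    k ∈ Λ.1 ↔ latticeDet p k = 0 := by
  have hpS : (fun i => (p i : ℝ)) ∈ realSpan Λ.1 := Submodule.subset_span ⟨p, hp, rfl⟩
  rw [← Λ.2.2 k]
  constructor
  · intro hk
    have h1 := (finrank_eq_one_iff_of_nonzero' (⟨_, hpS⟩ : realSpan Λ.1)
      (fun h => intCast_ne_zero hp0 (congrArg Subtype.val h))).1 Λ.2.1 ⟨_, hk⟩
    obtain ⟨c, hc⟩ := h1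
    exact latticeDet_eq_zero_of_smul (congrArg Subtype.val hc).symm
  · intro h
    obtain ⟨c, hc⟩ := exists_smul_of_latticeDet_eq_zero hp0 h
    rw [hc]
    exact Submodule.smul_mem _ _ hpS

lemma lattice_eq_of_mem {Λ Λ' : PrimitiveLattice} {p : Freq} (hp0 : p ≠ 0) (hp : p ∈ Λ.1)
    (hp' : p ∈ Λ'.1) : Λ = Λ' := by
  ext k
  rw [mem_lattice_iff Λ hp hp0, mem_lattice_iff Λ' hp' hp0]

lemma exists_lattice_mem {p : Freq} (hp : p ≠ 0) : ∃ Λ : PrimitiveLattice, p ∈ Λ.1 := by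
  let Λ : AddSubgroup Freq :=
    { carrier := {k | latticeDet p k = 0}
      zero_mem' := by simp [latticeDet]
      add_mem' := fun {a b} ha hb => by
        simp only [Set.mem_ofPred_eq, latticeDet, Pi.add_apply] at *
        linarith
      neg_mem' := fun {a} ha => by
        simp only [Set.mem_ofPred_eq, latticeDet, Pi.neg_apply] at *
        linarith }
  have hmem : ∀ k, k ∈ Λ ↔ latticeDet p k = 0 := fun k => Iff.rfl
  have hpΛ : p ∈ Λ := (hmem p).2 (by simp [latticeDet, mul_comm])
  have hspan : realSpan Λ = Submodule.span ℝ {fun i => (p i : ℝ)} := by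
    apply le_antisymm
    · refine Submodule.span_le.2 ?_
      rintro y ⟨k, hk, rfl⟩
      obtain ⟨c, hc⟩ := exists_smul_of_latticeDet_eq_zero hp ((hmem k).1 hk)
      rw [hc]
      exact Submodule.smul_mem _ _ (Submodule.mem_span_singleton_self _)
    · refine Submodule.span_le.2 ?_
      rintro y rfl
      exact Submodule.subset_span ⟨p, hpΛ, rfl⟩
  refine ⟨⟨Λ, ?_, fun k => ?_⟩, hpΛ⟩
  · rw [hspan, finrank_span_singleton (intCast_ne_zero hp)]
  · rw [hspan, Submodule.mem_span_singleton, hmem]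
    constructor
    · rintro ⟨c, hc⟩
      exact latticeDet_eq_zero_of_smul hc.symm
    · intro h
      obtain ⟨c, hc⟩ := exists_smul_of_latticeDet_eq_zero hp h
      exact ⟨c, hc.symm⟩

lemma generator_ne_zero {Λ : PrimitiveLattice} {v : Freq}
    (hv : AddSubgroup.zmultiples v = Λ.1) : v ≠ 0 := by
  rintro rfl
  have h1 := Λ.2.1
  have h2 : realSpan Λ.1 = ⊥ := by
    rw [realSpan, Submodule.span_eq_bot, ← hv]
    rintro y ⟨k, hk, rfl⟩
    simp only [AddSubgroup.zmultiples_zero_eq_bot, AddSubgroup.mem_bot] at hk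
    ext i
    simp [hk]
  rw [h2, finrank_bot] at h1
  exact zero_ne_one h1

lemma generator_mem {Λ : PrimitiveLattice} {v : Freq}
    (hv : AddSubgroup.zmultiples v = Λ.1) : v ∈ Λ.1 :=
  hv ▸ AddSubgroup.mem_zmultiples v

lemma freqSq_pos {v : Freq} (hv : v ≠ 0) : 0 < freqSq v := by
  have h : v 0 ≠ 0 ∨ v 1 ≠ 0 := by
    by_contra! h
    exact hv (by ext i; fin_cases i <;> simp [h.1, h.2])
  rw [freqSq]
  rcases h with h | h
  · have : (v 0 : ℝ) ≠ 0 := by exact_mod_cast h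
    positivity
  · have : (v 1 : ℝ) ≠ 0 := by exact_mod_cast h
    positivity

lemma freqSq_nonneg (v : Freq) : 0 ≤ freqSq v := by
  rw [freqSq]
  positivity

lemma vecLength_pos {v : Freq} (hv : v ≠ 0) : 0 < vecLength v := Real.sqrt_pos.2 (freqSq_pos hv)

lemma vecLength_sq (v : Freq) : vecLength v ^ 2 = freqSq v := Real.sq_sqrt (freqSq_nonneg v)

/-- The value `⟨m, v⟩ / ‖v‖` of the Hamiltonian on a lattice vector. -/
lemma latticeHamiltonian_intCast (v m : Freq) :
    latticeHamiltonian v (fun i => (m i : ℝ)) = freqDot m v / vecLength v := by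
  simp only [latticeHamiltonian, unitVec, Fin.sum_univ_two, freqDot]
  ring

/-- Two linearly independent lattice vectors control the length of a third one. -/
lemma freqSq_le_of_freqDot_le {p q m : Freq} (hdet : latticeDet p q ≠ 0) {R : ℝ}
    (hp : |freqDot m p| ≤ R) (hq : |freqDot m q| ≤ R) :
    freqSq m ≤ 2 * (freqSq p + freqSq q) * R ^ 2 := by
  set D : ℝ := (p 0 : ℝ) * q 1 - p 1 * q 0 with hD
  have hD1 : (1 : ℝ) ≤ D ^ 2 := by
    have h2 : (1 : ℤ) ≤ latticeDet p q ^ 2 := by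
      have : 0 < latticeDet p q ^ 2 := by positivity
      omega
    have h3 : ((latticeDet p q : ℤ) : ℝ) = D := by
      rw [latticeDet, hD]
      push_cast
      ring
    rw [← h3]
    exact_mod_cast h2
  have h0 : D * m 0 = q 1 * freqDot m p - p 1 * freqDot m q := by
    simp only [hD, freqDot]
    ring
  have h1 : D * m 1 = p 0 * freqDot m q - q 0 * freqDot m p := by
    simp only [hD, freqDot]
    ring
  have hp2 : freqDot m p ^ 2 ≤ R ^ 2 := sq_le_sq' (abs_le.1 hp).1 (abs_le.1 hp).2
  have hq2 : freqDot m q ^ 2 ≤ R ^ 2 := sq_le_sq' (abs_le.1 hq).1 (abs_le.1 hq).2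
  have hm := freqSq_nonneg m
  calc freqSq m ≤ D ^ 2 * freqSq m := le_mul_of_one_le_left hm hD1
    _ = (q 1 * freqDot m p - p 1 * freqDot m q) ^ 2
        + (p 0 * freqDot m q - q 0 * freqDot m p) ^ 2 := by
      rw [← h0, ← h1, freqSq]
      ring
    _ ≤ 2 * (freqSq q * freqDot m p ^ 2 + freqSq p * freqDot m q ^ 2) := by
      simp only [freqSq]
      nlinarith [sq_nonneg (q 1 * freqDot m p + p 1 * freqDot m q),
        sq_nonneg (p 0 * freqDot m q + q 0 * freqDot m p)]
    _ ≤ 2 * (freqSq q * R ^ 2 + freqSq p * R ^ 2) := by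
      have := freqSq_nonneg q
      have := freqSq_nonneg p
      gcongr
    _ = _ := by ring

/-! ### Words of elementary interactions -/

/-- An elementary interaction `(p, a, b)`: the multiplication by `e_p`, transported by the free
flow and integrated over the time interval `[a, b]`. -/
abbrev Letter : Type := Freq × ℝ × ℝ

/-- The total frequency shift of a word. -/
def wordShift (w : List Letter) : Freq := (w.map fun c => c.1).sum

/-- The weight `F` such that the word acts by `e_m ↦ F(m) e_{m + P}`, `P` the total shift. -/
def wordWeight (κ : ℝ) : List Letter → Freq → ℂ
  | [], _ => 1
  | (p, a, b) :: w, m =>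
    oscInt a b (κ * (freqDot (m + wordShift w) p + freqSq p / 2)) * wordWeight κ w m

/-- The leading part of `wordWeight`, in which the letters do not interact. -/
def wordMain (κ : ℝ) (w : List Letter) (m : Freq) : ℂ :=
  (w.map fun c => oscInt c.2.1 c.2.2 (κ * freqDot m c.1)).prod

/-- The action of a word on an element of `L²(𝕋²)`. -/
def wordVec (κ : ℝ) (w : List Letter) (ψ : L2Torus) : L2Torus :=
  wshift (wordShift w) (wordWeight κ w) ψ

/-- A bound for all the weights attached to a word. -/
def wordBound (w : List Letter) : ℝ := (w.map fun c => 1 + |c.2.2 - c.2.1|).prod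

lemma one_le_wordBound (w : List Letter) : 1 ≤ wordBound w := by
  refine List.one_le_prod fun x hx => ?_
  obtain ⟨c, -, rfl⟩ := List.mem_map.1 hx
  linarith [abs_nonneg (c.2.2 - c.2.1)]

lemma wordBound_cons (c : Letter) (w : List Letter) :
    wordBound (c :: w) = (1 + |c.2.2 - c.2.1|) * wordBound w := by
  simp [wordBound]

lemma norm_oscInt_le_one_add (a b θ : ℝ) : ‖oscInt a b θ‖ ≤ 1 + |b - a| :=
  (norm_oscInt_le a b θ).trans (by linarith)

lemma norm_wordWeight_le (κ : ℝ) (w : List Letter) (m : Freq) :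
    ‖wordWeight κ w m‖ ≤ wordBound w := by
  induction w with
  | nil => simp [wordWeight, wordBound]
  | cons c w ih =>
    obtain ⟨p, a, b⟩ := c
    rw [wordWeight, norm_mul, wordBound_cons]
    gcongr
    exact norm_oscInt_le_one_add _ _ _

lemma norm_prod_oscInt_le (w : List Letter) (θ : Letter → ℝ) :
    ‖(w.map fun c => oscInt c.2.1 c.2.2 (θ c)).prod‖ ≤ wordBound w := by
  induction w with
  | nil => simp [wordBound]
  | cons c w ih =>
    rw [List.map_cons, List.prod_cons, norm_mul, wordBound_cons]
    gcongr
    exact norm_oscInt_le_one_add _ _ _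

/-- A product of oscillatory integrals is as small as any of its factors. -/
lemma norm_prod_oscInt_le_mul {w : List Letter} {c : Letter} (hc : c ∈ w) (θ : Letter → ℝ) :
    ‖(w.map fun c => oscInt c.2.1 c.2.2 (θ c)).prod‖
      ≤ wordBound w * ‖oscInt c.2.1 c.2.2 (θ c)‖ := by
  induction w with
  | nil => simp at hc
  | cons d w ih =>
    rw [List.map_cons, List.prod_cons, norm_mul, wordBound_cons]
    have h1 := one_le_wordBound w
    rcases List.mem_cons.1 hc with rfl | hc
    · rw [mul_comm]
      gcongr
      refine (norm_prod_oscInt_le w θ).trans ?_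
      exact le_mul_of_one_le_left (by linarith) (by linarith [abs_nonneg (c.2.2 - c.2.1)])
    · rw [mul_assoc]
      gcongr
      · exact norm_oscInt_le_one_add _ _ _
      · exact ih hc

/-- The letters of a word commute up to `O(κ)`. -/
lemma exists_norm_wordWeight_sub_le (w : List Letter) : ∃ C, 0 ≤ C ∧ ∀ κ, 0 ≤ κ → ∀ m,
    ‖wordWeight κ w m - wordMain κ w m‖ ≤ C * κ := by
  induction w with
  | nil => exact ⟨0, le_rfl, fun κ _ m => by simp [wordWeight, wordMain]⟩
  | cons c w ih =>
    obtain ⟨C, hC0, hC⟩ := ih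
    obtain ⟨p, a, b⟩ := c
    set K := (|a| + |b|) * |freqDot (wordShift w) p + freqSq p / 2| * |b - a|
    have hw := one_le_wordBound w
    refine ⟨K * wordBound w + |b - a| * C, by positivity, fun κ hκ m => ?_⟩
    have h1 : ‖oscInt a b (κ * (freqDot (m + wordShift w) p + freqSq p / 2))
        - oscInt a b (κ * freqDot m p)‖ ≤ K * κ := by
      refine (norm_oscInt_sub_le _ _ _ _).trans_eq ?_
      rw [← mul_sub, freqDot_add_left, add_assoc, add_sub_cancel_left, abs_mul, abs_of_nonneg hκ]
      ring
    have h2 : wordWeight κ ((p, a, b) :: w) m - wordMain κ ((p, a, b) :: w) m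
        = (oscInt a b (κ * (freqDot (m + wordShift w) p + freqSq p / 2))
          - oscInt a b (κ * freqDot m p)) * wordWeight κ w m
          + oscInt a b (κ * freqDot m p) * (wordWeight κ w m - wordMain κ w m) := by
      simp only [wordWeight, wordMain, List.map_cons, List.prod_cons]
      ring
    rw [h2]
    refine (norm_add_le _ _).trans ?_
    rw [norm_mul, norm_mul]
    calc _ ≤ (K * κ) * wordBound w + |b - a| * (C * κ) := by
          gcongr
          · exact norm_wordWeight_le κ w m
          · exact norm_oscInt_le _ _ _
          · exact hC κ hκ m
      _ = _ := by ring

lemma fc_wordVec (κ : ℝ) (w : List Letter) (ψ : L2Torus) (n : Freq) :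
    fc (wordVec κ w ψ) n
      = wordWeight κ w (n - wordShift w) * fc ψ (n - wordShift w) :=
  fc_wshift _ (norm_wordWeight_le κ w) ψ n

/-- Integrating the transported potential against a word adds a letter to the word. -/
lemma integral_heisenberg_wordVec (κ : ℝ) {Z : C(Torus, ℂ)} {S : Finset Freq} {c : Freq → ℂ}
    (hZ : Z = ∑ p ∈ S, c p • UnitAddTorus.mFourier p) (w : List Letter) (ψ : L2Torus) (a b : ℝ) :
    ∫ r in a..b, heisenberg κ Z r (wordVec κ w ψ)
      = ∑ p ∈ S, c p • wordVec κ ((p, a, b) :: w) ψ := by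
  apply ext_fc
  intro n
  rw [fc_intervalIntegral (continuous_heisenberg κ Z continuous_const), fc_sum]
  have h1 : ∀ r, fc (heisenberg κ Z r (wordVec κ w ψ)) n = ∑ p ∈ S, (c p * fc (wordVec κ w ψ)
      (n - p)) * Complex.exp (((r * (κ * (freqDot (n - p) p + freqSq p / 2)) : ℝ) : ℂ)
        * Complex.I) := by
    intro r
    rw [heisenberg_apply, fc_freeFlow, hZ, map_sum, sum_apply, fc_sum,
      Finset.mul_sum]
    refine Finset.sum_congr rfl fun p _ => ?_
    rw [map_smul, smul_apply, fc_smul, fc_mulOp_mFourier, fc_freeFlow]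
    have h2 : freePhase (-(κ * r)) n * freePhase (κ * r) (n - p)
        = Complex.exp (((r * (κ * (freqDot (n - p) p + freqSq p / 2)) : ℝ) : ℂ)
          * Complex.I) := by
      rw [freePhase, freePhase, ← Complex.exp_add, ← add_mul]
      congr 2
      norm_cast
      simp only [freqSq, freqDot, Pi.sub_apply]
      push_cast
      ring
    rw [← h2]
    ring
  simp_rw [h1]
  rw [intervalIntegral.integral_finsetSum]
  · refine Finset.sum_congr rfl fun p _ => ?_
    rw [intervalIntegral.integral_const_mul, fc_smul, fc_wordVec, fc_wordVec, wordWeight]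
    have hs : wordShift ((p, a, b) :: w) = p + wordShift w := by simp [wordShift]
    have h3 : n - (p + wordShift w) = n - p - wordShift w := by abel
    rw [hs, h3, sub_add_cancel, oscInt]
    ring
  · intro p _
    exact Continuous.intervalIntegrable (by fun_prop) _ _

/-! ### Symbols of words and their mean values -/

/-- The points at which limit symbols are evaluated: `some (Λ, x, η)` is a point of the resonant
region attached to `Λ`, and `none` stands for the nonresonant region. -/
abbrev LimitPoint : Type := Option (PrimitiveLattice × Torus × ℝ)

open Classical in
/-- The limit symbol of a letter. Along `Λ` only the frequencies in `Λ` survive the averaging by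
the free flow; in the nonresonant region only the frequency `0` does. -/
def letterSymbol (v : PrimitiveLattice → Freq) (c : Letter) : LimitPoint → ℂ
  | none => if c.1 = 0 then ((c.2.2 - c.2.1 : ℝ) : ℂ) else 0
  | some (Λ, x, η) =>
    if c.1 ∈ Λ.1 then
      UnitAddTorus.mFourier c.1 x
        * oscInt c.2.1 c.2.2 (2 * Real.pi * η * (freqDot c.1 (v Λ) / vecLength (v Λ)))
    else 0

/-- The limit symbol of a word. -/
def wordSymbol (v : PrimitiveLattice → Freq) (w : List Letter) (y : LimitPoint) : ℂ :=
  (w.map fun c => letterSymbol v c y).prod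

/-- The limit of the quadratic forms with limit symbol `σ`: the measure `F Λ` describes the mass in
the resonant region of `Λ`, and the nonresonant region carries the rest of the total mass `1`. -/
def meanValue (F : PrimitiveLattice → Measure (Torus × ℝ)) (σ : LimitPoint → ℂ) : ℂ :=
  σ none * (1 - ((∑' Λ, (F Λ).real Set.univ : ℝ) : ℂ)) + ∑' Λ, ∫ p, σ (some (Λ, p)) ∂(F Λ)

/-- Bounded symbols, measurable in each resonant region. -/
def IsBoundedSymbol (σ : LimitPoint → ℂ) : Prop :=
  (∃ C, ∀ y, ‖σ y‖ ≤ C) ∧ ∀ Λ, Measurable fun p : Torus × ℝ => σ (some (Λ, p))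

lemma norm_letterSymbol_le (v : PrimitiveLattice → Freq) (c : Letter) (y : LimitPoint) :
    ‖letterSymbol v c y‖ ≤ 1 + |c.2.2 - c.2.1| := by
  have h0 : (0 : ℝ) ≤ 1 + |c.2.2 - c.2.1| := by positivity
  rcases y with _ | ⟨Λ, x, η⟩
  · rw [letterSymbol]
    split_ifs
    · rw [Complex.norm_real, Real.norm_eq_abs]
      linarith
    · simpa using h0
  · rw [letterSymbol]
    split_ifs
    · rw [norm_mul, norm_mFourier_apply, one_mul]
      exact norm_oscInt_le_one_add _ _ _
    · simpa using h0

lemma norm_wordSymbol_le (v : PrimitiveLattice → Freq) (w : List Letter) (y : LimitPoint) :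
    ‖wordSymbol v w y‖ ≤ wordBound w := by
  induction w with
  | nil => simp [wordSymbol, wordBound]
  | cons c w ih =>
    have : wordSymbol v (c :: w) y = letterSymbol v c y * wordSymbol v w y := by simp [wordSymbol]
    rw [this, norm_mul, wordBound_cons]
    gcongr
    exact norm_letterSymbol_le v c y

lemma continuous_letterSymbol (v : PrimitiveLattice → Freq) (c : Letter) (Λ : PrimitiveLattice) :
    Continuous fun p : Torus × ℝ => letterSymbol v c (some (Λ, p)) := by
  simp only [letterSymbol]
  split_ifs
  · have h1 : Continuous fun p : Torus × ℝ => UnitAddTorus.mFourier c.1 p.1 :=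
      (UnitAddTorus.mFourier c.1).continuous.comp continuous_fst
    have h2 : Continuous fun p : Torus × ℝ =>
        oscInt c.2.1 c.2.2 (2 * Real.pi * p.2 * (freqDot c.1 (v Λ) / vecLength (v Λ))) :=
      (continuous_oscInt _ _).comp (by fun_prop)
    exact h1.mul h2
  · exact continuous_const

lemma continuous_wordSymbol (v : PrimitiveLattice → Freq) (w : List Letter)
    (Λ : PrimitiveLattice) : Continuous fun p : Torus × ℝ => wordSymbol v w (some (Λ, p)) := by
  unfold wordSymbol
  induction w with
  | nil => simpa using continuous_const
  | cons c w ih =>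
    simp only [List.map_cons, List.prod_cons]
    exact (continuous_letterSymbol v c Λ).mul ih

lemma isBoundedSymbol_wordSymbol (v : PrimitiveLattice → Freq) (w : List Letter) :
    IsBoundedSymbol (wordSymbol v w) :=
  ⟨⟨_, norm_wordSymbol_le v w⟩, fun Λ => (continuous_wordSymbol v w Λ).measurable⟩

lemma IsBoundedSymbol.add {σ σ' : LimitPoint → ℂ} (h : IsBoundedSymbol σ)
    (h' : IsBoundedSymbol σ') : IsBoundedSymbol (σ + σ') := by
  obtain ⟨⟨C, hC⟩, hm⟩ := h
  obtain ⟨⟨C', hC'⟩, hm'⟩ := h'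
  exact ⟨⟨C + C', fun y => (norm_add_le _ _).trans (add_le_add (hC y) (hC' y))⟩,
    fun Λ => (hm Λ).add (hm' Λ)⟩

lemma IsBoundedSymbol.smul {σ : LimitPoint → ℂ} (c : ℂ) (h : IsBoundedSymbol σ) :
    IsBoundedSymbol (c • σ) := by
  obtain ⟨⟨C, hC⟩, hm⟩ := h
  refine ⟨⟨‖c‖ * C, fun y => ?_⟩, fun Λ => (hm Λ).const_smul c⟩
  rw [Pi.smul_apply, norm_smul]
  gcongr
  exact hC y

section MeanValue

variable {F : PrimitiveLattice → Measure (Torus × ℝ)}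

lemma meanValue_smul (c : ℂ) (σ : LimitPoint → ℂ) :
    meanValue F (c • σ) = c * meanValue F σ := by
  have h1 : ∀ Λ, ∫ p, (c • σ) (some (Λ, p)) ∂(F Λ) = c * ∫ p, σ (some (Λ, p)) ∂(F Λ) := fun Λ => by
    simp only [Pi.smul_apply, smul_eq_mul]
    exact integral_const_mul _ _
  simp only [meanValue, h1]
  rw [tsum_mul_left]
  simp only [Pi.smul_apply, smul_eq_mul]
  ring

lemma meanValue_const (c : ℂ) : meanValue F (fun _ => c) = c := by
  have h1 : ∀ Λ, ∫ _, c ∂(F Λ) = (((F Λ).real Set.univ : ℝ) : ℂ) * c := fun Λ => by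
    rw [integral_const, Complex.real_smul]
  simp only [meanValue, h1]
  rw [tsum_mul_right, ← Complex.ofReal_tsum]
  ring

variable [∀ Λ, IsFiniteMeasure (F Λ)]

lemma IsBoundedSymbol.integrable {σ : LimitPoint → ℂ} (h : IsBoundedSymbol σ)
    (Λ : PrimitiveLattice) : Integrable (fun p => σ (some (Λ, p))) (F Λ) := by
  obtain ⟨⟨C, hC⟩, hm⟩ := h
  exact Integrable.of_bound (hm Λ).aestronglyMeasurable C (Eventually.of_forall fun p => hC _)

lemma norm_integral_symbol_le {σ : LimitPoint → ℂ} {C : ℝ} (hC : ∀ y, ‖σ y‖ ≤ C)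
    (Λ : PrimitiveLattice) :
    ‖∫ p, σ (some (Λ, p)) ∂(F Λ)‖ ≤ C * (F Λ).real Set.univ :=
  norm_integral_le_of_norm_le_const (Eventually.of_forall fun _ => hC _)

lemma summable_integral_symbol (hF : Summable fun Λ => (F Λ).real Set.univ)
    {σ : LimitPoint → ℂ} {C : ℝ} (hC : ∀ y, ‖σ y‖ ≤ C) :
    Summable fun Λ => ∫ p, σ (some (Λ, p)) ∂(F Λ) :=
  Summable.of_norm_bounded (hF.mul_left C) fun Λ => norm_integral_symbol_le hC Λ

lemma meanValue_add (hF : Summable fun Λ => (F Λ).real Set.univ) {σ σ' : LimitPoint → ℂ}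
    (h : IsBoundedSymbol σ) (h' : IsBoundedSymbol σ') :
    meanValue F (σ + σ') = meanValue F σ + meanValue F σ' := by
  obtain ⟨C, hC⟩ := h.1
  obtain ⟨C', hC'⟩ := h'.1
  have h1 : ∀ Λ, ∫ p, (σ + σ') (some (Λ, p)) ∂(F Λ)
      = ∫ p, σ (some (Λ, p)) ∂(F Λ) + ∫ p, σ' (some (Λ, p)) ∂(F Λ) := fun Λ =>
    integral_add (h.integrable Λ) (h'.integrable Λ)
  simp only [meanValue, h1]
  rw [(summable_integral_symbol hF hC).tsum_add (summable_integral_symbol hF hC')]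
  simp only [Pi.add_apply]
  ring

lemma norm_meanValue_sub_le (hF : Summable fun Λ => (F Λ).real Set.univ) {σ σ' : LimitPoint → ℂ}
    (h : IsBoundedSymbol σ) (h' : IsBoundedSymbol σ') {η : ℝ} (hη : ∀ y, ‖σ y - σ' y‖ ≤ η) :
    ‖meanValue F σ - meanValue F σ'‖
      ≤ η * (‖1 - ((∑' Λ, (F Λ).real Set.univ : ℝ) : ℂ)‖ + ∑' Λ, (F Λ).real Set.univ) := by
  have h1 : meanValue F σ - meanValue F σ' = meanValue F (σ + (-1 : ℂ) • σ') := by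
    rw [meanValue_add hF h (h'.smul _), meanValue_smul]
    ring
  have h2 : ∀ y, ‖(σ + (-1 : ℂ) • σ') y‖ ≤ η := fun y => by
    simpa [sub_eq_add_neg] using hη y
  rw [h1, meanValue, mul_add]
  refine (norm_add_le _ _).trans (add_le_add ?_ ?_)
  · rw [norm_mul]
    gcongr
    exact h2 _
  · rw [← tsum_mul_left]
    exact tsum_of_norm_bounded (hF.mul_left η).hasSum fun Λ => norm_integral_symbol_le h2 Λ

end MeanValue

/-! ### Quadratic forms of words in the semiclassical limit -/

section Limit

variable {ι : Type*} {l : Filter ι} {κ : ι → ℝ} {ψ : ι → L2Torus}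

/-- Normalized families without mass at the frequencies `m` with `κ |m|` bounded, as `κ → 0`. -/
structure IsOscillating (l : Filter ι) (κ : ι → ℝ) (ψ : ι → L2Torus) : Prop where
  pos : ∀ᶠ j in l, 0 < κ j
  tendsto_zero : Tendsto κ l (𝓝 0)
  norm_eq_one : ∀ᶠ j in l, ‖ψ j‖ = 1
  low : ∀ R : ℝ, Tendsto (fun j =>
    ‖wshift 0 ({m | κ j ^ 2 * freqSq m ≤ R}.indicator fun _ => 1) (ψ j)‖) l (𝓝 0)

/-- The measures `F Λ` describe the mass of `ψ` at the frequencies almost orthogonal to `Λ`, tested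
against products of a character of frequency in `Λ` and a function of the rescaled distance to the
line orthogonal to `Λ`. -/
def HasTwoMicrolocalMeasures (l : Filter ι) (κ : ι → ℝ) (ψ : ι → L2Torus)
    (v : PrimitiveLattice → Freq) (F : PrimitiveLattice → Measure (Torus × ℝ)) : Prop :=
  ∀ Λ : PrimitiveLattice, ∀ P ∈ Λ.1, ∀ f : ℝ → ℂ, ContDiff ℝ ∞ f → HasCompactSupport f →
    Tendsto (fun j => inner ℂ (ψ j) (wshift P
        (fun m => f (κ j * freqDot m (v Λ) / (2 * Real.pi * vecLength (v Λ)))) (ψ j))) l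
      (𝓝 (∫ p, UnitAddTorus.mFourier P p.1 * f p.2 ∂(F Λ)))

lemma tendsto_of_forall_approx {E : ι → ℂ} {L : ℂ}
    (h : ∀ η > 0, ∃ (E' : ι → ℂ) (L' : ℂ), Tendsto E' l (𝓝 L') ∧ ‖L' - L‖ ≤ η ∧
      ∀ᶠ j in l, ‖E j - E' j‖ ≤ η) : Tendsto E l (𝓝 L) := by
  rw [Metric.tendsto_nhds]
  intro ρ hρ
  obtain ⟨E', L', hE', hL', hE⟩ := h (ρ / 4) (by positivity)
  filter_upwards [hE, Metric.tendsto_nhds.1 hE' (ρ / 4) (by positivity)] with j h1 h2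
  rw [dist_eq_norm] at h2 ⊢
  calc ‖E j - L‖ = ‖(E j - E' j) + (E' j - L') + (L' - L)‖ := by ring_nf
    _ ≤ ‖E j - E' j‖ + ‖E' j - L'‖ + ‖L' - L‖ := norm_add₃_le
    _ < ρ := by linarith

lemma norm_inner_wshift_sub_le (P : Freq) {G K : Freq → ℂ} {C D η : ℝ} (hG : ∀ m, ‖G m‖ ≤ C)
    (hK : ∀ m, ‖K m‖ ≤ D) (hη : ∀ m, ‖G m - K m‖ ≤ η) {φ : L2Torus} (hφ : ‖φ‖ = 1) :
    ‖(inner ℂ φ (wshift P G φ) : ℂ) - inner ℂ φ (wshift P K φ)‖ ≤ η := by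
  rw [← inner_sub_right, wshift_sub P hG hK]
  refine (norm_inner_le_norm _ _).trans ?_
  rw [hφ, one_mul]
  exact (norm_wshift_le P hη φ).trans_eq (by rw [hφ, mul_one])

lemma norm_wordMain_le (κ : ℝ) (w : List Letter) (m : Freq) :
    ‖wordMain κ w m‖ ≤ wordBound w :=
  norm_prod_oscInt_le w fun c => κ * freqDot m c.1

lemma tendsto_inner_wordVec_of_wordMain (hψ : IsOscillating l κ ψ) {w : List Letter} {L : ℂ}
    (h : Tendsto (fun j => inner ℂ (ψ j) (wshift (wordShift w) (wordMain (κ j) w) (ψ j))) l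
      (𝓝 L)) :
    Tendsto (fun j => inner ℂ (ψ j) (wordVec (κ j) w (ψ j))) l (𝓝 L) := by
  obtain ⟨C, -, hC⟩ := exists_norm_wordWeight_sub_le w
  have h0 : Tendsto (fun j => (inner ℂ (ψ j) (wordVec (κ j) w (ψ j)) : ℂ)
      - inner ℂ (ψ j) (wshift (wordShift w) (wordMain (κ j) w) (ψ j))) l (𝓝 0) := by
    have hz : Tendsto (fun j => C * κ j) l (𝓝 0) := by
      simpa using hψ.tendsto_zero.const_mul C
    refine squeeze_zero_norm' ?_ hz
    filter_upwards [hψ.pos, hψ.norm_eq_one] with j hj h1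
    exact norm_inner_wshift_sub_le _ (norm_wordWeight_le _ w) (norm_wordMain_le _ w)
      (hC _ hj.le) h1
  simpa using h0.add h

/-- Words of zero frequencies act as constants. -/
lemma tendsto_inner_wordVec_of_all_zero (hψ : IsOscillating l κ ψ)
    (v : PrimitiveLattice → Freq) {F : PrimitiveLattice → Measure (Torus × ℝ)}
    {w : List Letter} (hw : ∀ c ∈ w, c.1 = 0) :
    Tendsto (fun j => inner ℂ (ψ j) (wordVec (κ j) w (ψ j))) l
      (𝓝 (meanValue F (wordSymbol v w))) := by
  set C : ℂ := (w.map fun c => ((c.2.2 - c.2.1 : ℝ) : ℂ)).prod with hC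
  have h1 : wordSymbol v w = fun _ => C := by
    ext y
    rw [wordSymbol, hC]
    congr 1
    refine List.map_congr_left fun c hc => ?_
    rcases y with _ | ⟨Λ, x, η⟩
    · simp [letterSymbol, hw c hc]
    · simp [letterSymbol, hw c hc, Λ.1.zero_mem, UnitAddTorus.mFourier_zero, freqDot, oscInt_zero]
  have h2 : ∀ j, wordMain (κ j) w = fun _ => C := by
    intro j
    ext m
    rw [wordMain, hC]
    congr 1
    refine List.map_congr_left fun c hc => ?_
    simp [hw c hc, freqDot, oscInt_zero]
  have h3 : wordShift w = 0 := by
    rw [wordShift]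
    refine List.sum_eq_zero fun x hx => ?_
    obtain ⟨c, hc, rfl⟩ := List.mem_map.1 hx
    exact hw c hc
  rw [h1, meanValue_const]
  refine tendsto_inner_wordVec_of_wordMain hψ ?_
  refine tendsto_const_nhds.congr' ?_
  filter_upwards [hψ.norm_eq_one] with j hj
  have h4 : wshift (wordShift w) (wordMain (κ j) w) (ψ j) = C • ψ j := by
    apply ext_fc
    intro n
    rw [h2, h3, fc_wshift 0 (fun _ => le_rfl), fc_smul, sub_zero]
  rw [h4, inner_smul_right, inner_self_eq_norm_sq_to_K, hj]
  simp

/-- Words containing two independent frequencies are only resonant at low frequencies, hence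
negligible. -/
lemma tendsto_inner_wordVec_of_independent (hψ : IsOscillating l κ ψ)
    (v : PrimitiveLattice → Freq) {F : PrimitiveLattice → Measure (Torus × ℝ)}
    {w : List Letter} {c d : Letter} (hc : c ∈ w) (hd : d ∈ w)
    (hcd : latticeDet c.1 d.1 ≠ 0) :
    Tendsto (fun j => inner ℂ (ψ j) (wordVec (κ j) w (ψ j))) l
      (𝓝 (meanValue F (wordSymbol v w))) := by
  have hc0 : c.1 ≠ 0 := fun h => hcd (by simp [latticeDet, h])
  have hd0 : d.1 ≠ 0 := fun h => hcd (by simp [latticeDet, h])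
  have h1 : wordSymbol v w = fun _ => 0 := by
    ext y
    rw [wordSymbol, List.prod_eq_zero_iff, List.mem_map]
    rcases y with _ | ⟨Λ, x, η⟩
    · exact ⟨c, hc, by simp [letterSymbol, hc0]⟩
    · by_cases hcΛ : c.1 ∈ Λ.1
      · refine ⟨d, hd, ?_⟩
        have : d.1 ∉ Λ.1 := fun h => hcd ((mem_lattice_iff Λ hcΛ hc0 _).1 h)
        simp [letterSymbol, this]
      · exact ⟨c, hc, by simp [letterSymbol, hcΛ]⟩
  rw [h1, meanValue_const]
  refine tendsto_inner_wordVec_of_wordMain hψ (tendsto_of_forall_approx fun η hη => ?_)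
  refine ⟨fun _ => 0, 0, tendsto_const_nhds, by simpa using hη.le, ?_⟩
  have hB := one_le_wordBound w
  -- Outside `[-R, R]`, the oscillatory integrals are so small that the word is at most `η / 2`.
  set R : ℝ := 4 * wordBound w / η with hR
  have hRpos : 0 < R := by positivity
  have hlarge : ∀ e ∈ w, ∀ θ : Letter → ℝ, R < |θ e| →
      ‖(w.map fun c => oscInt c.2.1 c.2.2 (θ c)).prod‖ ≤ η / 2 := by
    intro e he θ hθ
    have hθ0 : θ e ≠ 0 := abs_pos.1 (hRpos.trans hθ)
    calc _ ≤ wordBound w * ‖oscInt e.2.1 e.2.2 (θ e)‖ := norm_prod_oscInt_le_mul he θ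
      _ ≤ wordBound w * (2 / |θ e|) := by
        gcongr
        exact norm_oscInt_le_two_div _ _ hθ0
      _ ≤ wordBound w * (2 / R) := by gcongr
      _ = η / 2 := by
        rw [hR]
        field_simp
        norm_num
  have hlow := (hψ.low (2 * (freqSq c.1 + freqSq d.1) * R ^ 2)).const_mul (wordBound w)
  rw [mul_zero] at hlow
  filter_upwards [hψ.pos, hψ.norm_eq_one, hlow.eventually_le_const (half_pos hη)] with j hκ hn hj
  rw [sub_zero]
  refine (norm_inner_le_norm _ _).trans ?_
  rw [hn, one_mul]
  refine (norm_wshift_le_of_small_off _ _ (half_pos hη).le (norm_wordMain_le (κ j) w)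
    (fun m hm => ?_) (ψ j)).trans ((add_le_add_right hj _).trans ?_)
  · by_cases hcm : R < |κ j * freqDot m c.1|
    · exact hlarge c hc (fun e => κ j * freqDot m e.1) hcm
    · by_cases hdm : R < |κ j * freqDot m d.1|
      · exact hlarge d hd (fun e => κ j * freqDot m e.1) hdm
      · exfalso
        apply hm
        rw [abs_mul, abs_of_pos hκ, not_lt, ← le_div_iff₀' hκ] at hcm hdm
        have := freqSq_le_of_freqDot_le hcd hcm hdm
        rw [Set.mem_ofPred_eq]
        calc κ j ^ 2 * freqSq m
            ≤ κ j ^ 2 * (2 * (freqSq c.1 + freqSq d.1) * (R / κ j) ^ 2) := by gcongr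
          _ = _ := by field_simp
  · rw [hn]
    linarith

end Limit

section Limit

variable {ι : Type*} {l : Filter ι} {κ : ι → ℝ} {ψ : ι → L2Torus}

lemma mFourier_wordShift (w : List Letter) (x : Torus) :
    UnitAddTorus.mFourier (wordShift w) x
      = (w.map fun c => UnitAddTorus.mFourier c.1 x).prod := by
  induction w with
  | nil => simp [wordShift, UnitAddTorus.mFourier_zero]
  | cons c w ih =>
    have : wordShift (c :: w) = c.1 + wordShift w := by simp [wordShift]
    rw [this, UnitAddTorus.mFourier_add, ih, List.map_cons, List.prod_cons]

/-- The smooth cutoff equal to `1` on `[-R, R]` and supported in `[-R - 1, R + 1]`. -/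
def cutoff (R : ℝ) (hR : 0 < R) : ContDiffBump (0 : ℝ) := ⟨R, R + 1, hR, by linarith⟩

lemma cutoff_eq_one {R : ℝ} (hR : 0 < R) {η : ℝ} (h : |η| ≤ R) : cutoff R hR η = 1 :=
  (cutoff R hR).one_of_mem_closedBall (by simpa [cutoff] using h)

lemma cutoff_eq_zero {R : ℝ} (hR : 0 < R) {η : ℝ} (h : R + 1 ≤ |η|) : cutoff R hR η = 0 :=
  (cutoff R hR).zero_of_le_dist (by simpa [cutoff] using h)

lemma contDiff_cutoff {R : ℝ} (hR : 0 < R) : ContDiff ℝ ∞ fun η => ((cutoff R hR η : ℝ) : ℂ) :=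
  Complex.ofRealCLM.contDiff.comp (cutoff R hR).contDiff

lemma hasCompactSupport_cutoff {R : ℝ} (hR : 0 < R) :
    HasCompactSupport fun η => ((cutoff R hR η : ℝ) : ℂ) :=
  (cutoff R hR).hasCompactSupport.comp_left Complex.ofReal_zero

lemma norm_cutoff_le {R : ℝ} (hR : 0 < R) (η : ℝ) : ‖((cutoff R hR η : ℝ) : ℂ)‖ ≤ 1 := by
  rw [Complex.norm_real, Real.norm_of_nonneg (cutoff R hR).nonneg]
  exact (cutoff R hR).le_one

lemma contDiff_prod_oscInt (w : List Letter) (θ : Letter → ℝ) :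
    ContDiff ℝ ∞ fun η : ℝ => (w.map fun c => oscInt c.2.1 c.2.2 (2 * Real.pi * η * θ c)).prod := by
  induction w with
  | nil => simpa using contDiff_const
  | cons c w ih =>
    simp only [List.map_cons, List.prod_cons]
    exact ((contDiff_oscInt _ _).comp (by fun_prop)).mul ih

/-- Words whose frequencies all lie in the same lattice `Λ` and do not all vanish see only the
measure attached to `Λ`. -/
lemma tendsto_inner_wordVec_of_mem (hψ : IsOscillating l κ ψ)
    {v : PrimitiveLattice → Freq} (hv : ∀ Λ, AddSubgroup.zmultiples (v Λ) = Λ.1)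
    {F : PrimitiveLattice → Measure (Torus × ℝ)} [∀ Λ, IsFiniteMeasure (F Λ)]
    (hF : HasTwoMicrolocalMeasures l κ ψ v F)
    {w : List Letter} {Λ : PrimitiveLattice} (hw : ∀ c ∈ w, c.1 ∈ Λ.1) {d : Letter}
    (hd : d ∈ w) (hd0 : d.1 ≠ 0) :
    Tendsto (fun j => inner ℂ (ψ j) (wordVec (κ j) w (ψ j))) l
      (𝓝 (meanValue F (wordSymbol v w))) := by
  set L := vecLength (v Λ) with hL
  have hLpos : 0 < L := vecLength_pos (generator_ne_zero (hv Λ))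
  set H : ℝ → ℂ := fun η =>
    (w.map fun c => oscInt c.2.1 c.2.2 (2 * Real.pi * η * (freqDot c.1 (v Λ) / L))).prod with hH
  have hnone : wordSymbol v w none = 0 := by
    rw [wordSymbol, List.prod_eq_zero_iff, List.mem_map]
    exact ⟨d, hd, by simp [letterSymbol, hd0]⟩
  have hother : ∀ Λ' ≠ Λ, ∫ p, wordSymbol v w (some (Λ', p)) ∂(F Λ') = 0 := by
    intro Λ' hΛ'
    have : ∀ p : Torus × ℝ, wordSymbol v w (some (Λ', p)) = 0 := by
      intro p
      rw [wordSymbol, List.prod_eq_zero_iff, List.mem_map]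
      refine ⟨d, hd, ?_⟩
      have hdΛ : d.1 ∉ Λ'.1 := fun h => hΛ' (lattice_eq_of_mem hd0 h (hw d hd))
      simp [letterSymbol, hdΛ]
    simp [this]
  have hsame : ∀ p : Torus × ℝ, wordSymbol v w (some (Λ, p))
      = UnitAddTorus.mFourier (wordShift w) p.1 * H p.2 := by
    intro p
    rw [wordSymbol, mFourier_wordShift, hH, ← List.prod_map_mul]
    congr 1
    refine List.map_congr_left fun c hc => ?_
    simp [letterSymbol, hw c hc, hL]
  have hmean : meanValue F (wordSymbol v w)
      = ∫ p, UnitAddTorus.mFourier (wordShift w) p.1 * H p.2 ∂(F Λ) := by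
    rw [meanValue, hnone, zero_mul, zero_add, tsum_eq_single Λ hother]
    simp_rw [hsame]
  have hmain : ∀ j m, wordMain (κ j) w m = H (κ j * freqDot m (v Λ) / (2 * Real.pi * L)) := by
    intro j m
    rw [wordMain, hH]
    congr 1
    refine List.map_congr_left fun c hc => ?_
    have hcΛ := hw c hc
    rw [← hv Λ, AddSubgroup.mem_zmultiples_iff] at hcΛ
    obtain ⟨n, hn⟩ := hcΛ
    have h1 : freqDot c.1 (v Λ) = n * L ^ 2 := by
      rw [hL, vecLength_sq, ← hn]
      simp only [freqDot, freqSq, Pi.smul_apply, smul_eq_mul]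
      push_cast
      ring
    have h2 : freqDot m c.1 = n * freqDot m (v Λ) := by
      rw [← hn]
      simp only [freqDot, Pi.smul_apply, smul_eq_mul]
      push_cast
      ring
    rw [h1, h2]
    congr 1
    have := Real.pi_pos
    field_simp
  have hHb : ∀ η, ‖H η‖ ≤ wordBound w := fun η => norm_prod_oscInt_le w _
  have hHc : ContDiff ℝ ∞ H := contDiff_prod_oscInt w _
  have hB := one_le_wordBound w
  have hdot : freqDot d.1 (v Λ) / L ≠ 0 := by
    have hdΛ := hw d hd
    rw [← hv Λ, AddSubgroup.mem_zmultiples_iff] at hdΛ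
    obtain ⟨n, hn⟩ := hdΛ
    have hn0 : (n : ℝ) ≠ 0 := by
      rintro h
      have : n = 0 := by exact_mod_cast h
      exact hd0 (by rw [← hn, this, zero_smul])
    have h1 : freqDot d.1 (v Λ) = n * L ^ 2 := by
      rw [hL, vecLength_sq, ← hn]
      simp only [freqDot, freqSq, Pi.smul_apply, smul_eq_mul]
      push_cast
      ring
    rw [h1]
    positivity
  rw [hmean]
  refine tendsto_inner_wordVec_of_wordMain hψ (tendsto_of_forall_approx fun η hη => ?_)
  -- Truncating `H` at a radius beyond which it is small gives an admissible test function.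
  set M := (F Λ).real Set.univ with hM
  have hM0 : 0 ≤ M := measureReal_nonneg
  set ρ := η / (1 + M) with hρ
  have hρpos : 0 < ρ := by positivity
  have hρη : ρ ≤ η := div_le_self hη.le (by linarith)
  set D := |2 * Real.pi * (freqDot d.1 (v Λ) / L)| with hD
  have hDpos : 0 < D := abs_pos.2 (mul_ne_zero (by positivity) hdot)
  set R := 2 * wordBound w / (ρ * D) with hR
  have hRpos : 0 < R := by positivity
  have hsmall : ∀ x, R ≤ |x| → ‖H x‖ ≤ ρ := by
    intro x hx
    have hx0 : x ≠ 0 := abs_pos.1 (hRpos.trans_le hx)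
    have habs : |2 * Real.pi * x * (freqDot d.1 (v Λ) / L)| = D * |x| := by
      rw [hD, ← abs_mul]
      congr 1
      ring
    calc _ ≤ wordBound w * ‖oscInt d.2.1 d.2.2 (2 * Real.pi * x * (freqDot d.1 (v Λ) / L))‖ :=
          norm_prod_oscInt_le_mul hd fun c => 2 * Real.pi * x * (freqDot c.1 (v Λ) / L)
      _ ≤ wordBound w * (2 / (D * |x|)) := by
        gcongr
        rw [← habs]
        exact norm_oscInt_le_two_div _ _ (mul_ne_zero (mul_ne_zero (by positivity) hx0) hdot)
      _ ≤ wordBound w * (2 / (D * R)) := by gcongr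
      _ = ρ := by
        rw [hR]
        field_simp
  set f : ℝ → ℂ := fun x => ((cutoff R hRpos x : ℝ) : ℂ) * H x with hf
  have hfH : ∀ x, ‖H x - f x‖ ≤ ρ := by
    intro x
    have h1 : H x - f x = ((1 - cutoff R hRpos x : ℝ) : ℂ) * H x := by
      simp only [hf]
      push_cast
      ring
    have h2 : 0 ≤ cutoff R hRpos x := (cutoff R hRpos).nonneg
    have h3 : cutoff R hRpos x ≤ 1 := (cutoff R hRpos).le_one
    rw [h1, norm_mul, Complex.norm_real, Real.norm_of_nonneg (by linarith)]
    rcases le_total |x| R with hx | hx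
    · rw [cutoff_eq_one hRpos hx, sub_self, zero_mul]
      exact hρpos.le
    · calc _ ≤ 1 * ρ := by
            gcongr
            · linarith
            · exact hsmall x hx
        _ = ρ := one_mul ρ
  have hfb : ∀ x, ‖f x‖ ≤ wordBound w := fun x => by
    rw [hf, norm_mul]
    exact (mul_le_mul (norm_cutoff_le hRpos x) (hHb x) (norm_nonneg _) zero_le_one).trans_eq
      (one_mul _)
  have hfc : ContDiff ℝ ∞ f := (contDiff_cutoff hRpos).mul hHc
  have hfs : HasCompactSupport f := (hasCompactSupport_cutoff hRpos).mul_right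
  have hP : wordShift w ∈ Λ.1 := by
    refine list_sum_mem fun x hx => ?_
    obtain ⟨c, hc, rfl⟩ := List.mem_map.1 hx
    exact hw c hc
  refine ⟨_, _, hF Λ (wordShift w) hP f hfc hfs, ?_, ?_⟩
  · have hint : ∀ g : ℝ → ℂ, Continuous g → (∀ x, ‖g x‖ ≤ wordBound w) →
        Integrable (fun p : Torus × ℝ => UnitAddTorus.mFourier (wordShift w) p.1 * g p.2)
          (F Λ) := by
      intro g hg hgb
      refine Integrable.of_bound (C := wordBound w) ?_ (Eventually.of_forall fun p => ?_)
      · exact (((UnitAddTorus.mFourier (wordShift w)).continuous.comp continuous_fst).mul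
          (hg.comp continuous_snd)).aestronglyMeasurable
      · rw [norm_mul, norm_mFourier_apply, one_mul]
        exact hgb _
    rw [← integral_sub (hint f hfc.continuous hfb) (hint H hHc.continuous hHb)]
    refine (norm_integral_le_of_norm_le_const (C := ρ) (Eventually.of_forall fun p => ?_)).trans ?_
    · rw [← mul_sub, norm_mul, norm_mFourier_apply, one_mul, norm_sub_rev]
      exact hfH _
    · rw [hρ, div_mul_eq_mul_div, div_le_iff₀ (by positivity)]
      nlinarith
  · filter_upwards [hψ.norm_eq_one] with j hj
    refine norm_inner_wshift_sub_le _ (norm_wordMain_le (κ j) w) (fun m => hfb _) (fun m => ?_) hj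
    rw [hmain]
    exact (hfH _).trans hρη

lemma tendsto_inner_wordVec (hψ : IsOscillating l κ ψ)
    {v : PrimitiveLattice → Freq} (hv : ∀ Λ, AddSubgroup.zmultiples (v Λ) = Λ.1)
    {F : PrimitiveLattice → Measure (Torus × ℝ)} [∀ Λ, IsFiniteMeasure (F Λ)]
    (hF : HasTwoMicrolocalMeasures l κ ψ v F) (w : List Letter) :
    Tendsto (fun j => inner ℂ (ψ j) (wordVec (κ j) w (ψ j))) l
      (𝓝 (meanValue F (wordSymbol v w))) := by
  by_cases h0 : ∀ c ∈ w, c.1 = 0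
  · exact tendsto_inner_wordVec_of_all_zero hψ v h0
  push Not at h0
  obtain ⟨d, hd, hd0⟩ := h0
  by_cases hdet : ∀ c ∈ w, latticeDet d.1 c.1 = 0
  · obtain ⟨Λ, hΛ⟩ := exists_lattice_mem hd0
    exact tendsto_inner_wordVec_of_mem hψ hv hF
      (fun c hc => (mem_lattice_iff Λ hΛ hd0 _).2 (hdet c hc)) hd hd0
  · push Not at hdet
    obtain ⟨c, hc, hdc⟩ := hdet
    exact tendsto_inner_wordVec_of_independent hψ v hd hc hdc

/-! ### The total resonant mass -/

/-- The resonant regions of finitely many lattices are disjoint up to low frequencies, so that the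
total resonant mass does not exceed the total mass. -/
lemma norm_sum_integral_cutoff_le [l.NeBot] (hψ : IsOscillating l κ ψ)
    {v : PrimitiveLattice → Freq} (hv : ∀ Λ, AddSubgroup.zmultiples (v Λ) = Λ.1)
    {F : PrimitiveLattice → Measure (Torus × ℝ)}
    (hF : HasTwoMicrolocalMeasures l κ ψ v F) (s : Finset PrimitiveLattice) {R : ℝ}
    (hR : 0 < R) : ‖∑ Λ ∈ s, ∫ p, ((cutoff R hR p.2 : ℝ) : ℂ) ∂(F Λ)‖ ≤ 1 := by
  have hlen : ∀ Λ, 0 < vecLength (v Λ) := fun Λ => vecLength_pos (generator_ne_zero (hv Λ))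
  set χ : ℝ → ℂ := fun η => ((cutoff R hR η : ℝ) : ℂ) with hχ
  set x : ι → PrimitiveLattice → Freq → ℝ := fun j Λ m =>
    κ j * freqDot m (v Λ) / (2 * Real.pi * vecLength (v Λ)) with hx
  set G : ι → Freq → ℂ := fun j m => ∑ Λ ∈ s, χ (x j Λ m) with hG
  have hGb : ∀ j m, ‖G j m‖ ≤ s.card := fun j m => by
    refine (norm_sum_le _ _).trans ?_
    exact (Finset.sum_le_card_nsmul s _ 1 fun Λ _ => norm_cutoff_le hR (x j Λ m)).trans_eq
      (by simp)
  have hlim : Tendsto (fun j => inner ℂ (ψ j) (wshift 0 (G j) (ψ j))) l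
      (𝓝 (∑ Λ ∈ s, ∫ p, χ p.2 ∂(F Λ))) := by
    have h1 := tendsto_finsetSum s fun Λ _ =>
      hF Λ 0 Λ.1.zero_mem χ (contDiff_cutoff hR) (hasCompactSupport_cutoff hR)
    simp only [UnitAddTorus.mFourier_zero, ContinuousMap.one_apply, one_mul] at h1
    refine h1.congr fun j => ?_
    rw [← inner_sum]
    congr 1
    apply ext_fc
    intro n
    rw [fc_sum, fc_wshift 0 (hGb j), hG, Finset.sum_mul]
    exact Finset.sum_congr rfl fun Λ _ => fc_wshift 0 (fun m => norm_cutoff_le hR (x j Λ m)) _ _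
  set K : ℝ := ∑ Λ ∈ s, 2 * Real.pi * vecLength (v Λ) * (R + 1) with hK
  have hKle : ∀ Λ ∈ s, 2 * Real.pi * vecLength (v Λ) * (R + 1) ≤ K := fun Λ hΛ =>
    Finset.single_le_sum (f := fun Λ => 2 * Real.pi * vecLength (v Λ) * (R + 1))
      (fun Λ _ => by have := hlen Λ; positivity) hΛ
  set T : ℝ := ∑ Λ ∈ s, freqSq (v Λ) with hT
  have hTle : ∀ Λ ∈ s, freqSq (v Λ) ≤ T := fun Λ hΛ =>
    Finset.single_le_sum (f := fun Λ => freqSq (v Λ)) (fun Λ _ => freqSq_nonneg _) hΛ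
  have hoff : ∀ j, 0 < κ j → ∀ m, m ∉ {m | κ j ^ 2 * freqSq m ≤ 2 * (T + T) * K ^ 2} →
      ‖G j m‖ ≤ 1 := by
    intro j hκ m hm
    have hfree : ∀ Λ ∈ s, χ (x j Λ m) ≠ 0 → |freqDot m (v Λ)| ≤ K / κ j := by
      intro Λ hΛ h
      have h1 : |x j Λ m| < R + 1 := by
        by_contra! h2
        exact h (by simp [hχ, cutoff_eq_zero hR h2])
      have h2 : |x j Λ m| = κ j * |freqDot m (v Λ)| / (2 * Real.pi * vecLength (v Λ)) := by
        have := hlen Λ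
        rw [hx, abs_div, abs_mul, abs_of_pos hκ,
          abs_of_pos (show 0 < 2 * Real.pi * vecLength (v Λ) by positivity)]
      have hpos : 0 < 2 * Real.pi * vecLength (v Λ) := by
        have := hlen Λ
        positivity
      rw [h2, div_lt_iff₀ hpos] at h1
      rw [le_div_iff₀' hκ]
      linarith [hKle Λ hΛ]
    by_cases hex : ∃ Λ ∈ s, χ (x j Λ m) ≠ 0
    · obtain ⟨Λ, hΛ, hne⟩ := hex
      have h1 : G j m = χ (x j Λ m) := by
        refine Finset.sum_eq_single_of_mem Λ hΛ fun Λ' hΛ' hΛΛ' => ?_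
        by_contra hne'
        have hdet : latticeDet (v Λ) (v Λ') ≠ 0 := by
          intro h
          have hmem := (mem_lattice_iff Λ (generator_mem (hv Λ))
            (generator_ne_zero (hv Λ)) (v Λ')).2 h
          exact hΛΛ' (lattice_eq_of_mem (generator_ne_zero (hv Λ')) (generator_mem (hv Λ')) hmem)
        have h2 := freqSq_le_of_freqDot_le hdet (hfree Λ hΛ hne) (hfree Λ' hΛ' hne')
        apply hm
        rw [Set.mem_ofPred_eq]
        calc κ j ^ 2 * freqSq m
            ≤ κ j ^ 2 * (2 * (T + T) * (K / κ j) ^ 2) := by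
              refine mul_le_mul_of_nonneg_left (h2.trans ?_) (by positivity)
              have := hTle Λ hΛ
              have := hTle Λ' hΛ'
              gcongr
          _ = _ := by field_simp
      rw [h1]
      exact norm_cutoff_le hR _
    · push Not at hex
      have h1 : G j m = 0 := Finset.sum_eq_zero hex
      rw [h1, norm_zero]
      exact zero_le_one
  have hlow := ((hψ.low (2 * (T + T) * K ^ 2)).const_mul (s.card : ℝ)).const_add 1
  rw [mul_zero, add_zero] at hlow
  refine le_of_tendsto_of_tendsto hlim.norm hlow ?_
  filter_upwards [hψ.pos, hψ.norm_eq_one] with j hκ hn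
  refine (norm_inner_le_norm _ _).trans ?_
  rw [hn, one_mul]
  refine (norm_wshift_le_of_small_off 0 _ zero_le_one (hGb j) (hoff j hκ) (ψ j)).trans ?_
  rw [hn, one_mul]

lemma summable_resonant_mass [l.NeBot] (hψ : IsOscillating l κ ψ)
    {v : PrimitiveLattice → Freq} (hv : ∀ Λ, AddSubgroup.zmultiples (v Λ) = Λ.1)
    {F : PrimitiveLattice → Measure (Torus × ℝ)} [∀ Λ, IsFiniteMeasure (F Λ)]
    (hF : HasTwoMicrolocalMeasures l κ ψ v F) :
    Summable fun Λ => (F Λ).real Set.univ := by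
  refine summable_of_sum_le (c := 1) (fun Λ => measureReal_nonneg) fun s => ?_
  have hpos : ∀ n : ℕ, (0 : ℝ) < n + 1 := fun n => by positivity
  have h1 : ∀ Λ, Tendsto (fun n : ℕ => ∫ p, ((cutoff (n + 1) (hpos n) p.2 : ℝ) : ℂ) ∂(F Λ)) atTop
      (𝓝 (((F Λ).real Set.univ : ℝ) : ℂ)) := by
    intro Λ
    have h2 : (((F Λ).real Set.univ : ℝ) : ℂ) = ∫ _ : Torus × ℝ, (1 : ℂ) ∂(F Λ) := by simp
    rw [h2]
    refine tendsto_integral_of_dominated_convergence (fun _ => 1) (fun n => ?_)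
      (integrable_const _) (fun n => Eventually.of_forall fun p => norm_cutoff_le (hpos n) p.2)
      (Eventually.of_forall fun p => ?_)
    · exact ((contDiff_cutoff (hpos n)).continuous.comp continuous_snd).aestronglyMeasurable
    · refine tendsto_const_nhds.congr' ?_
      filter_upwards [eventually_ge_atTop ⌈|p.2|⌉₊] with n hn
      have : |p.2| ≤ (n : ℝ) + 1 := by
        have := Nat.le_of_ceil_le hn
        linarith
      rw [cutoff_eq_one (hpos n) this, Complex.ofReal_one]
  have h3 := (tendsto_finsetSum s fun Λ _ => h1 Λ).norm
  have h4 := le_of_tendsto h3 (Eventually.of_forall fun n =>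
    norm_sum_integral_cutoff_le hψ hv hF s (hpos n))
  rw [← Complex.ofReal_sum, Complex.norm_real] at h4
  exact (le_abs_self _).trans h4

/-! ### The limit of the sliced evolution -/

/-- The limit symbol of the potential integrated over the time interval `[a, b]`. -/
def sliceSymbol (v : PrimitiveLattice → Freq) (S : Finset Freq) (c : Freq → ℂ) (a b : ℝ)
    (y : LimitPoint) : ℂ := ∑ p ∈ S, c p * letterSymbol v (p, a, b) y

/-- Families of vectors obtained from words, together with their limit symbols. -/
def wordSpan (κ : ι → ℝ) (ψ : ι → L2Torus) (v : PrimitiveLattice → Freq) :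
    Submodule ℂ ((ι → L2Torus) × (LimitPoint → ℂ)) :=
  Submodule.span ℂ (Set.range fun w => (fun j => wordVec (κ j) w (ψ j), wordSymbol v w))

lemma slice_mem_wordSpan {v : PrimitiveLattice → Freq} {Z : C(Torus, ℂ)} {S : Finset Freq}
    {c : Freq → ℂ} (hZ : Z = ∑ p ∈ S, c p • UnitAddTorus.mFourier p) (a b : ℝ)
    {x : (ι → L2Torus) × (LimitPoint → ℂ)} (hx : x ∈ wordSpan κ ψ v) :
    ((fun j => ∫ r in a..b, heisenberg (κ j) Z r (x.1 j), x.2 * sliceSymbol v S c a b)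
      : (ι → L2Torus) × (LimitPoint → ℂ)) ∈ wordSpan κ ψ v := by
  have hcont : ∀ j (φ : L2Torus), IntervalIntegrable (fun r => heisenberg (κ j) Z r φ) volume a b :=
    fun j φ => (continuous_heisenberg (κ j) Z continuous_const).intervalIntegrable a b
  induction hx using Submodule.span_induction with
  | mem x hx =>
    obtain ⟨w, rfl⟩ := hx
    have : ((fun j => ∫ r in a..b, heisenberg (κ j) Z r (wordVec (κ j) w (ψ j)),
        wordSymbol v w * sliceSymbol v S c a b) : (ι → L2Torus) × (LimitPoint → ℂ))
        = ∑ p ∈ S, c p • ((fun j => wordVec (κ j) ((p, a, b) :: w) (ψ j),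
          wordSymbol v ((p, a, b) :: w)) : (ι → L2Torus) × (LimitPoint → ℂ)) := by
      ext1
      · ext1 j
        simp only [integral_heisenberg_wordVec (κ j) hZ, Prod.fst_sum, Prod.smul_fst,
          Finset.sum_apply, Pi.smul_apply]
      · ext1 y
        simp only [Prod.snd_sum, Prod.smul_snd, Finset.sum_apply, Pi.smul_apply, smul_eq_mul,
          Pi.mul_apply, sliceSymbol, wordSymbol, List.map_cons, List.prod_cons, Finset.mul_sum]
        exact Finset.sum_congr rfl fun p _ => by ring
    rw [this]
    exact Submodule.sum_mem _ fun p _ => Submodule.smul_mem _ _ (Submodule.subset_span ⟨_, rfl⟩)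
  | zero =>
    convert Submodule.zero_mem (wordSpan κ ψ v) using 1
    ext1
    · ext1 j
      simp
    · simp
  | add x x' _ _ h h' =>
    convert Submodule.add_mem _ h h' using 1
    ext1
    · ext1 j
      simp only [Prod.fst_add, Pi.add_apply, map_add]
      exact intervalIntegral.integral_add (hcont j _) (hcont j _)
    · simp only [Prod.snd_add, add_mul]
  | smul t x _ h =>
    convert Submodule.smul_mem _ t h using 1
    ext1
    · ext1 j
      simp only [Prod.smul_fst, Pi.smul_apply, map_smul]
      exact intervalIntegral.integral_smul _ _
    · simp only [Prod.smul_snd, smul_mul_assoc]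

lemma wordVec_nil (κ : ℝ) (φ : L2Torus) : wordVec κ [] φ = φ := by
  apply ext_fc
  intro n
  simp [fc_wordVec, wordWeight, wordShift]

lemma backwardSlices_mem_wordSpan {v : PrimitiveLattice → Freq} {Z : C(Torus, ℂ)}
    {S : Finset Freq} {c : Freq → ℂ} (hZ : Z = ∑ p ∈ S, c p • UnitAddTorus.mFourier p)
    (s : ℕ → ℝ) (n : ℕ) :
    ((fun j => backwardSlices (heisenberg (κ j) Z) s (ψ j) n,
      fun y => ∏ k ∈ Finset.range n, (1 + Complex.I * sliceSymbol v S c (s (k + 1)) (s k) y))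
      : (ι → L2Torus) × (LimitPoint → ℂ)) ∈ wordSpan κ ψ v := by
  induction n with
  | zero =>
    refine Submodule.subset_span ⟨[], ?_⟩
    ext1
    · ext1 j
      simp [backwardSlices, wordVec_nil]
    · ext1 y
      simp [wordSymbol]
  | succ n ih =>
    convert Submodule.add_mem _ ih (Submodule.smul_mem _ Complex.I
      (slice_mem_wordSpan hZ (s (n + 1)) (s n) ih)) using 1
    ext1
    · rfl
    · ext1 y
      simp only [Finset.prod_range_succ, Prod.snd_add, Prod.smul_snd, Pi.add_apply, Pi.smul_apply,
        Pi.mul_apply, smul_eq_mul]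
      ring

/-- The quadratic form of the sliced evolution converges to the mean value of the product of the
limit symbols of the slices. -/
lemma tendsto_inner_backwardSlices [l.NeBot] (hψ : IsOscillating l κ ψ)
    {v : PrimitiveLattice → Freq} (hv : ∀ Λ, AddSubgroup.zmultiples (v Λ) = Λ.1)
    {F : PrimitiveLattice → Measure (Torus × ℝ)} [∀ Λ, IsFiniteMeasure (F Λ)]
    (hF : HasTwoMicrolocalMeasures l κ ψ v F) {Z : C(Torus, ℂ)}
    {S : Finset Freq} {c : Freq → ℂ} (hZ : Z = ∑ p ∈ S, c p • UnitAddTorus.mFourier p)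
    (s : ℕ → ℝ) (n : ℕ) :
    IsBoundedSymbol (fun y => ∏ k ∈ Finset.range n,
      (1 + Complex.I * sliceSymbol v S c (s (k + 1)) (s k) y)) ∧
    Tendsto (fun j => inner ℂ (ψ j) (backwardSlices (heisenberg (κ j) Z) s (ψ j) n)) l
      (𝓝 (meanValue F fun y => ∏ k ∈ Finset.range n,
        (1 + Complex.I * sliceSymbol v S c (s (k + 1)) (s k) y))) := by
  have hsum := summable_resonant_mass hψ hv hF
  have key : ∀ x ∈ wordSpan κ ψ v, IsBoundedSymbol x.2 ∧
      Tendsto (fun j => inner ℂ (ψ j) (x.1 j)) l (𝓝 (meanValue F x.2)) := by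
    intro x hx
    induction hx using Submodule.span_induction with
    | mem x hx =>
      obtain ⟨w, rfl⟩ := hx
      exact ⟨isBoundedSymbol_wordSymbol v w, tendsto_inner_wordVec hψ hv hF w⟩
    | zero =>
      refine ⟨⟨⟨0, fun y => by simp⟩, fun Λ => measurable_const⟩, ?_⟩
      have : meanValue F (0 : LimitPoint → ℂ) = 0 := meanValue_const 0
      simp [this]
    | add x x' _ _ h h' =>
      refine ⟨h.1.add h'.1, ?_⟩
      rw [Prod.snd_add, meanValue_add hsum h.1 h'.1]
      simpa [inner_add_right] using h.2.add h'.2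
    | smul t x _ h =>
      refine ⟨h.1.smul t, ?_⟩
      rw [Prod.smul_snd, meanValue_smul]
      simpa [inner_smul_right] using h.2.const_mul t
  exact key _ (backwardSlices_mem_wordSpan hZ s n)

end Limit

/-! ### Averages along closed orbits -/

lemma continuous_proj : Continuous proj :=
  continuous_pi fun i => (AddCircle.continuous_mk' 1).comp (continuous_apply i)

lemma vecLength_perp (v : Freq) : vecLength (perp v) = vecLength v := by
  simp [vecLength, perp, add_comm]

lemma mFourier_add_proj_unitVec (p v : Freq) (x : Torus) (t : ℝ) :
    UnitAddTorus.mFourier p (x + proj (t • unitVec v))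
      = UnitAddTorus.mFourier p x
        * Complex.exp (((t * (2 * Real.pi * (freqDot p v / vecLength v)) : ℝ) : ℂ)
          * Complex.I) := by
  rw [mFourier_add_point, mFourier_proj]
  congr 2
  simp only [unitVec, Pi.smul_apply, smul_eq_mul, freqDot]
  push_cast
  ring

lemma freqDot_perp (p v : Freq) : freqDot p (perp v) = latticeDet v p := by
  simp only [freqDot, perp, latticeDet, Matrix.cons_val_zero, Matrix.cons_val_one]
  push_cast
  ring

lemma integral_exp_period (k : ℤ) {L : ℝ} (hL : 0 < L) :
    ∫ t in (0 : ℝ)..L, Complex.exp (((t * (2 * Real.pi * (k / L)) : ℝ) : ℂ) * Complex.I)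
      = if k = 0 then (L : ℂ) else 0 := by
  split_ifs with hk
  · simp [hk]
  · have hkR : (k : ℂ) ≠ 0 := by exact_mod_cast hk
    have hLc : (L : ℂ) ≠ 0 := by exact_mod_cast hL.ne'
    have hpi : (Real.pi : ℂ) ≠ 0 := by exact_mod_cast Real.pi_ne_zero
    have hc : (2 * Real.pi * (k / L) * Complex.I : ℂ) ≠ 0 := by
      simp [hkR, hLc, hpi]
    have h1 := integral_exp_mul_complex (a := 0) (b := L) hc
    have h2 : ∀ t : ℝ, Complex.exp (((t * (2 * Real.pi * (k / L)) : ℝ) : ℂ) * Complex.I)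
        = Complex.exp ((2 * Real.pi * (k / L) * Complex.I : ℂ) * t) := fun t => by
      congr 1
      push_cast
      ring
    simp_rw [h2, h1]
    have h3 : Complex.exp ((2 * Real.pi * (k / L) * Complex.I : ℂ) * L) = 1 := by
      rw [Complex.exp_eq_one_iff]
      exact ⟨k, by field_simp⟩
    simp [h3]

/-- The average along the orbits directed by `v^⊥` keeps the characters orthogonal to `v^⊥` and
kills the others. -/
lemma latticeAverage_mFourier_mul {v : Freq} (hv : v ≠ 0) (p : Freq) (z : ℂ) (x : Torus) :
    latticeAverage v (fun y => UnitAddTorus.mFourier p y * z) x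
      = if latticeDet v p = 0 then UnitAddTorus.mFourier p x * z else 0 := by
  have hL := vecLength_pos hv
  have hLc : (vecLength v : ℂ) ≠ 0 := by exact_mod_cast hL.ne'
  have h1 : ∀ t : ℝ, UnitAddTorus.mFourier p (x + proj (t • unitVec (perp v))) * z
      = (UnitAddTorus.mFourier p x * z) * Complex.exp (((t * (2 * Real.pi
        * ((latticeDet v p : ℤ) / vecLength v)) : ℝ) : ℂ) * Complex.I) := fun t => by
    rw [mFourier_add_proj_unitVec, vecLength_perp, freqDot_perp]
    ring
  simp_rw [latticeAverage, h1]
  rw [intervalIntegral.integral_const_mul, integral_exp_period _ hL, Complex.real_smul]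
  split_ifs
  · push_cast
    field_simp
  · simp

lemma integral_mFourier (p : Freq) :
    ∫ x, UnitAddTorus.mFourier p x ∂torusMeasure = if p = 0 then 1 else 0 := by
  have h1 : fc (basisVec p) 0 = ∫ x, UnitAddTorus.mFourier p x ∂torusMeasure := by
    have := UnitAddTorus.mFourierCoeff_toLp (UnitAddTorus.mFourier p) 0
    refine this.trans ?_
    rw [UnitAddTorus.mFourierCoeff]
    simp only [neg_zero, UnitAddTorus.mFourier_zero, ContinuousMap.one_apply, one_smul]
    rfl
  rw [← h1, fc_eq_inner, ← torusBasis_apply, ← torusBasis_apply,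
    orthonormal_iff_ite.1 torusBasis.orthonormal]
  simp [eq_comm]

/-- The average of the potential seen at a limit point after a rescaled time `s`: the average along
the orbits attached to `Λ`, transported by the flow, at a resonant point, and the average over the
torus at the nonresonant point. -/
def orbitAverage (v : PrimitiveLattice → Freq) (V : Torus → ℝ) : LimitPoint → ℝ → ℝ
  | none, _ => ∫ x, V x ∂torusMeasure
  | some (Λ, x, η), s => latticeAverage (v Λ) V (x + proj ((s * η) • unitVec (v Λ)))

lemma continuous_latticeAverage (v : Freq) (V : C(Torus, ℝ)) :
    Continuous (latticeAverage v V) := by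
  have h1 : Continuous fun q : Torus × ℝ => q.1 + proj (q.2 • unitVec (perp v)) :=
    continuous_fst.add (continuous_proj.comp (by fun_prop))
  have h2 : Continuous fun x : Torus =>
      ∫ t in (0 : ℝ)..vecLength v, V (x + proj (t • unitVec (perp v))) :=
    intervalIntegral.continuous_parametric_intervalIntegral_of_continuous'
      (f := fun x t => V (x + proj (t • unitVec (perp v)))) (V.continuous.comp h1) _ _
  exact continuous_const.mul h2

lemma continuous_orbitAverage_uncurry (v : PrimitiveLattice → Freq) (V : C(Torus, ℝ))
    (Λ : PrimitiveLattice) :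
    Continuous fun q : (Torus × ℝ) × ℝ => orbitAverage v V (some (Λ, q.1)) q.2 := by
  have h1 : Continuous fun q : (Torus × ℝ) × ℝ =>
      q.1.1 + proj ((q.2 * q.1.2) • unitVec (v Λ)) :=
    (continuous_fst.comp continuous_fst).add (continuous_proj.comp (by fun_prop))
  exact (continuous_latticeAverage (v Λ) V).comp h1

lemma continuous_orbitAverage (v : PrimitiveLattice → Freq) (V : C(Torus, ℝ)) (y : LimitPoint) :
    Continuous (orbitAverage v V y) := by
  rcases y with _ | ⟨Λ, p⟩
  · exact continuous_const
  · exact (continuous_orbitAverage_uncurry v V Λ).comp (continuous_const.prodMk continuous_id)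

lemma abs_latticeAverage_le {v : Freq} (hv : v ≠ 0) {V : Torus → ℝ} {C : ℝ} (hC : ∀ x, |V x| ≤ C)
    (x : Torus) : |latticeAverage v V x| ≤ C := by
  have hL := vecLength_pos hv
  have h1 := intervalIntegral.norm_integral_le_of_norm_le_const (a := 0) (b := vecLength v)
    (f := fun t => V (x + proj (t • unitVec (perp v)))) fun t _ => hC _
  rw [latticeAverage, smul_eq_mul, abs_mul, abs_of_pos (inv_pos.2 hL)]
  rw [sub_zero, abs_of_pos hL, Real.norm_eq_abs] at h1
  calc _ ≤ (vecLength v)⁻¹ * (C * vecLength v) := by gcongr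
    _ = C := by field_simp

lemma abs_orbitAverage_le {v : PrimitiveLattice → Freq} (hv : ∀ Λ, v Λ ≠ 0) {V : Torus → ℝ}
    {C : ℝ} (hC : ∀ x, |V x| ≤ C) (y : LimitPoint) (s : ℝ) : |orbitAverage v V y s| ≤ C := by
  rcases y with _ | ⟨Λ, x, η⟩
  · have := norm_integral_le_of_norm_le_const (μ := torusMeasure) (f := V) (C := C)
      (Eventually.of_forall hC)
    change |∫ x, V x ∂torusMeasure| ≤ C
    simpa using this
  · exact abs_latticeAverage_le (hv Λ) hC _

lemma orbitAverage_sub (v : PrimitiveLattice → Freq) (V Z : C(Torus, ℝ)) (y : LimitPoint) (s : ℝ) :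
    orbitAverage v V y s - orbitAverage v Z y s = orbitAverage v (V - Z) y s := by
  rcases y with _ | ⟨Λ, x, η⟩
  · have hi : ∀ W : C(Torus, ℝ), Integrable W torusMeasure := fun W =>
      W.continuous.integrable_of_hasCompactSupport (HasCompactSupport.of_compactSpace _)
    exact (integral_sub (hi V) (hi Z)).symm
  · simp only [orbitAverage, latticeAverage, Pi.sub_apply]
    rw [← smul_sub, ← intervalIntegral.integral_sub]
    all_goals
      refine Continuous.intervalIntegrable ?_ _ _
      refine (ContinuousMap.continuous _).comp ?_
      exact continuous_const.add (continuous_proj.comp (by fun_prop))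

open Classical in
/-- The limit symbols of the slices of a trigonometric polynomial are the integrals over the
slices of its orbit averages. -/
lemma sliceSymbol_eq {v : PrimitiveLattice → Freq}
    (hv : ∀ Λ, AddSubgroup.zmultiples (v Λ) = Λ.1) {Z : C(Torus, ℝ)} {S : Finset Freq}
    {c : Freq → ℂ} (hZ : ∀ x, (Z x : ℂ) = ∑ p ∈ S, c p * UnitAddTorus.mFourier p x)
    (a b : ℝ) (y : LimitPoint) :
    sliceSymbol v S c a b y = ((∫ s in a..b, orbitAverage v Z y s : ℝ) : ℂ) := by
  rw [← intervalIntegral.integral_ofReal, sliceSymbol]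
  rcases y with _ | ⟨Λ, x, η⟩
  · have h1 : ((∫ x, Z x ∂torusMeasure : ℝ) : ℂ) = ∑ p ∈ S, c p * if p = 0 then 1 else 0 := by
      rw [← integral_complex_ofReal]
      simp_rw [hZ]
      rw [integral_finsetSum]
      · exact Finset.sum_congr rfl fun p _ => by rw [integral_const_mul, integral_mFourier]
      · intro p _
        exact ((UnitAddTorus.mFourier p).continuous.integrable_of_hasCompactSupport
          (HasCompactSupport.of_compactSpace _)).const_mul _
    simp only [orbitAverage, h1, letterSymbol]
    rw [intervalIntegral.integral_const, Complex.real_smul, Finset.mul_sum]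
    refine Finset.sum_congr rfl fun p _ => ?_
    split_ifs <;> simp [mul_comm]
  · have hv0 := generator_ne_zero (hv Λ)
    have h1 : ∀ z : Torus, ((latticeAverage (v Λ) Z z : ℝ) : ℂ)
        = ∑ p ∈ S, c p * if p ∈ Λ.1 then UnitAddTorus.mFourier p z else 0 := by
      intro z
      have h2 : ((latticeAverage (v Λ) Z z : ℝ) : ℂ)
          = ∑ p ∈ S, latticeAverage (v Λ) (fun y => UnitAddTorus.mFourier p y * c p) z := by
        simp only [latticeAverage, smul_eq_mul, Complex.real_smul]
        rw [Complex.ofReal_mul, ← intervalIntegral.integral_ofReal, ← Finset.mul_sum,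
          ← intervalIntegral.integral_finsetSum]
        · simp_rw [hZ, mul_comm (c _)]
        · intro p _
          refine Continuous.intervalIntegrable (Continuous.mul ?_ continuous_const) _ _
          refine (ContinuousMap.continuous _).comp ?_
          exact continuous_const.add (continuous_proj.comp (by fun_prop))
      rw [h2]
      refine Finset.sum_congr rfl fun p _ => ?_
      rw [latticeAverage_mFourier_mul hv0]
      simp only [mem_lattice_iff Λ (generator_mem (hv Λ)) hv0]
      split_ifs <;> ring
    simp only [orbitAverage, h1, mFourier_add_proj_unitVec]
    rw [intervalIntegral.integral_finsetSum]
    · refine Finset.sum_congr rfl fun p _ => ?_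
      rw [intervalIntegral.integral_const_mul]
      congr 1
      simp only [letterSymbol]
      split_ifs
      · rw [intervalIntegral.integral_const_mul, oscInt]
        congr 2
        ext1 s
        congr 3
        ring
      · simp
    · intro p _
      refine Continuous.intervalIntegrable (continuous_const.mul ?_) _ _
      split_ifs <;> fun_prop

/-! ### Trigonometric approximation of the potential -/

lemma exists_trigonometric_approx (V : C(Torus, ℝ)) {δ : ℝ} (hδ : 0 < δ) :
    ∃ (Z : C(Torus, ℝ)) (S : Finset Freq) (c : Freq → ℂ),
      (∀ x, (Z x : ℂ) = ∑ p ∈ S, c p * UnitAddTorus.mFourier p x) ∧ ∀ x, |V x - Z x| ≤ δ := by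
  set T : Submodule ℂ C(Torus, ℂ) := Submodule.span ℂ (Set.range UnitAddTorus.mFourier) with hT
  set Vc : C(Torus, ℂ) := ⟨fun x => (V x : ℂ), Complex.continuous_ofReal.comp V.continuous⟩
  have hmem : Vc ∈ closure (T : Set C(Torus, ℂ)) := by
    have h1 := UnitAddTorus.span_mFourier_closure_eq_top (d := Fin 2)
    rw [← Submodule.topologicalClosure_coe, h1]
    trivial
  obtain ⟨Q, hQT, hQ⟩ := Metric.mem_closure_iff.1 hmem δ hδ
  have hstar : ∀ f ∈ T, star f ∈ T := by
    intro f hf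
    induction hf using Submodule.span_induction with
    | mem f hf =>
      obtain ⟨p, rfl⟩ := hf
      refine Submodule.subset_span ⟨-p, ?_⟩
      ext x
      exact UnitAddTorus.mFourier_neg
    | zero => simp
    | add f g _ _ hf hg =>
      rw [star_add]
      exact T.add_mem hf hg
    | smul a f _ hf =>
      rw [star_smul]
      exact T.smul_mem _ hf
  have hre : (2⁻¹ : ℂ) • (Q + star Q) ∈ T := T.smul_mem _ (T.add_mem hQT (hstar Q hQT))
  obtain ⟨c, hc⟩ := Finsupp.mem_span_range_iff_exists_finsupp.1 hre
  refine ⟨⟨fun x => (Q x).re, Complex.continuous_re.comp Q.continuous⟩, c.support, c,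
    fun x => ?_, fun x => ?_⟩
  · have h1 := congrArg (fun f : C(Torus, ℂ) => f x) hc
    simp only [Finsupp.sum, ContinuousMap.coe_sum, Finset.sum_apply, ContinuousMap.smul_apply,
      smul_eq_mul, ContinuousMap.add_apply, ContinuousMap.star_apply] at h1
    rw [h1]
    simp only [ContinuousMap.coe_mk]
    rw [show (star (Q x) : ℂ) = starRingEnd ℂ (Q x) from rfl, Complex.add_conj]
    push_cast
    ring
  · have h1 : ‖Vc x - Q x‖ ≤ δ := by
      rw [← dist_eq_norm]
      exact (ContinuousMap.dist_apply_le_dist x).trans hQ.le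
    have h2 : V x - (Q x).re = (Vc x - Q x).re := by simp [Vc]
    change |V x - (Q x).re| ≤ δ
    rw [h2]
    exact (Complex.abs_re_le_norm _).trans h1

/-! ### Products of slices and exponentials -/

lemma norm_prod_one_add_sub_exp_le (φ : ℕ → ℝ) {e : ℝ} (he1 : e ≤ 1) (hφ : ∀ k, |φ k| ≤ e)
    (n : ℕ) : ‖∏ k ∈ Finset.range n, (1 + Complex.I * (φ k : ℂ))
      - Complex.exp (Complex.I * ((∑ k ∈ Finset.range n, φ k : ℝ) : ℂ))‖
      ≤ n * (e ^ 2 * (1 + e) ^ n) := by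
  have he : 0 ≤ e := (abs_nonneg _).trans (hφ 0)
  induction n with
  | zero => simp
  | succ n ih =>
    set A := ∏ k ∈ Finset.range n, (1 + Complex.I * (φ k : ℂ))
    set E := Complex.exp (Complex.I * ((∑ k ∈ Finset.range n, φ k : ℝ) : ℂ))
    have h1 : Complex.exp (Complex.I * ((∑ k ∈ Finset.range (n + 1), φ k : ℝ) : ℂ))
        = E * Complex.exp (Complex.I * (φ n : ℂ)) := by
      rw [← Complex.exp_add, Finset.sum_range_succ]
      push_cast
      ring_nf
    have hn : ‖Complex.I * (φ n : ℂ)‖ ≤ e := by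
      rw [norm_mul, Complex.norm_I, one_mul, Complex.norm_real]
      exact hφ n
    have h2 : ‖Complex.exp (Complex.I * (φ n : ℂ)) - 1 - Complex.I * (φ n : ℂ)‖ ≤ e ^ 2 := by
      refine (Complex.norm_exp_sub_one_sub_id_le (hn.trans he1)).trans ?_
      gcongr
    have hE : ‖E‖ = 1 := by
      rw [show E = Complex.exp (((∑ k ∈ Finset.range n, φ k : ℝ) : ℂ) * Complex.I) by
        rw [mul_comm]]
      exact Complex.norm_exp_ofReal_mul_I _
    have h3 : ‖(1 : ℂ) + Complex.I * (φ n : ℂ)‖ ≤ 1 + e := by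
      refine (norm_add_le _ _).trans ?_
      rw [norm_one]
      linarith
    rw [Finset.prod_range_succ, h1]
    have h4 : A * (1 + Complex.I * (φ n : ℂ)) - E * Complex.exp (Complex.I * (φ n : ℂ))
        = (A - E) * (1 + Complex.I * (φ n : ℂ))
          - E * (Complex.exp (Complex.I * (φ n : ℂ)) - 1 - Complex.I * (φ n : ℂ)) := by ring
    have h5 : (1 : ℝ) ≤ (1 + e) ^ (n + 1) := one_le_pow₀ (by linarith)
    rw [h4]
    calc _ ≤ ‖A - E‖ * ‖(1 : ℂ) + Complex.I * (φ n : ℂ)‖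
          + ‖E‖ * ‖Complex.exp (Complex.I * (φ n : ℂ)) - 1 - Complex.I * (φ n : ℂ)‖ := by
          refine (norm_sub_le _ _).trans ?_
          rw [norm_mul, norm_mul]
      _ ≤ n * (e ^ 2 * (1 + e) ^ n) * (1 + e) + 1 * e ^ 2 := by
        rw [hE]
        gcongr
      _ ≤ n * (e ^ 2 * (1 + e) ^ n) * (1 + e) + e ^ 2 * (1 + e) ^ (n + 1) := by
        rw [one_mul]
        gcongr
        exact le_mul_of_one_le_right (sq_nonneg e) h5
      _ = _ := by
        push_cast
        ring

lemma norm_exp_I_mul_sub_le (a b : ℝ) :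
    ‖Complex.exp (Complex.I * (a : ℂ)) - Complex.exp (Complex.I * (b : ℂ))‖ ≤ |a - b| := by
  have h3 : Complex.exp (Complex.I * (a : ℂ)) - Complex.exp (Complex.I * (b : ℂ))
      = Complex.exp ((b : ℂ) * Complex.I)
        * (Complex.exp (Complex.I * ((a - b : ℝ) : ℂ)) - 1) := by
    rw [mul_sub, ← Complex.exp_add, mul_one]
    push_cast
    ring_nf
  rw [h3, norm_mul, Complex.norm_exp_ofReal_mul_I, one_mul]
  exact Real.norm_exp_I_mul_ofReal_sub_one_le

/-! ### Quantization of symbols resonant along a lattice -/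

lemma toL2_const_mul_mFourier (z : ℂ) (k : Freq) :
    toL2 (fun x => z * UnitAddTorus.mFourier k x) = z • basisVec k := by
  have h1 : (fun x => z * UnitAddTorus.mFourier k x)
      =ᵐ[torusMeasure] (z • basisVec k : L2Torus) := by
    filter_upwards [Lp.coeFn_smul z (basisVec k), UnitAddTorus.coeFn_mFourierLp 2 k] with x hx hx2
    rw [hx, Pi.smul_apply, smul_eq_mul]
    congr 1
    exact hx2.symm
  have h2 : MemLp (fun x => z * UnitAddTorus.mFourier k x) 2 torusMeasure :=
    (memLp_congr_ae h1).2 (Lp.memLp _)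
  rw [toL2, dif_pos h2]
  exact Lp.ext (h2.coeFn_toLp.trans h1)

/-- The quantization of `e_P(x) f(ħ H(ξ) / ε)`, for `P` in the lattice generated by `v`, is a
weighted shift. -/
lemma twoMicrolocal_eq_inner {v P : Freq} (hv : v ≠ 0) (hP : latticeDet v P = 0) (h ε : ℝ)
    (φ : L2Torus) {f : ℝ → ℂ} {C : ℝ} (hf : ∀ x, ‖f x‖ ≤ C) :
    twoMicrolocal v h ε φ (fun p => UnitAddTorus.mFourier P p.1 * f p.2)
      = inner ℂ φ (wshift P (fun m => f (4 * Real.pi ^ 2 * h ^ 2 / ε * freqDot m v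
        / (2 * Real.pi * vecLength v))) φ) := by
  rw [twoMicrolocal]
  congr 1
  set G : Freq → ℂ := fun m => f (4 * Real.pi ^ 2 * h ^ 2 / ε * freqDot m v
    / (2 * Real.pi * vecLength v)) with hG
  have hGb : ∀ m, ‖G m‖ ≤ C := fun m => hf _
  have hH : ∀ k : Freq, h * latticeHamiltonian v (fun i => 2 * Real.pi * h * (k i : ℝ)) / ε
      = 4 * Real.pi ^ 2 * h ^ 2 / ε * freqDot k v / (2 * Real.pi * vecLength v) := by
    intro k
    have h1 : latticeHamiltonian v (fun i => 2 * Real.pi * h * (k i : ℝ))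
        = 2 * Real.pi * h * (freqDot k v / vecLength v) := by
      rw [← latticeHamiltonian_intCast, latticeHamiltonian, latticeHamiltonian, Finset.mul_sum]
      exact Finset.sum_congr rfl fun i _ => by ring
    rw [h1]
    have := Real.pi_ne_zero
    have := (vecLength_pos hv).ne'
    field_simp
    ring
  have hterm : ∀ k : Freq, UnitAddTorus.mFourierCoeff φ k • toL2 (fun x =>
      twoMicrolocalSymbol v h ε (fun p => UnitAddTorus.mFourier P p.1 * f p.2) x
        (fun i => 2 * Real.pi * h * (k i : ℝ)) * UnitAddTorus.mFourier k x)
      = (G k * fc φ k) • basisVec (k + P) := by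
    intro k
    have h1 : (fun x => twoMicrolocalSymbol v h ε (fun p => UnitAddTorus.mFourier P p.1 * f p.2) x
        (fun i => 2 * Real.pi * h * (k i : ℝ)) * UnitAddTorus.mFourier k x)
        = fun x => G k * UnitAddTorus.mFourier (k + P) x := by
      ext x
      rw [twoMicrolocalSymbol]
      dsimp only
      rw [latticeAverage_mFourier_mul hv, if_pos hP, hH,
        UnitAddTorus.mFourier_add]
      ring
    rw [h1, toL2_const_mul_mFourier, smul_smul, mul_comm]
    rfl
  rw [quantize]
  simp_rw [hterm]
  have h2 := hasSum_ofCoeff (memℓp_wshift P hGb φ)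
  have h3 := (Equiv.addRight P).hasSum_iff.2 h2
  refine Eq.trans ?_ h3.tsum_eq
  congr 1
  ext1 k
  simp

/-! ### Consequences of the hypotheses on the initial data -/

section Hypotheses

variable {ι : Type*} {l : Filter ι} {ħ ε : ι → ℝ} {ψ : ι → L2Torus}

lemma isOscillating_of_spectralProjector (hħ : Tendsto ħ l (𝓝[>] 0))
    (hε_pos : ∀ᶠ j in l, 0 < ε j) (hε_large : Tendsto (fun j => ħ j ^ 2 / ε j) l (𝓝 0))
    (hε_small : Tendsto (fun j => ε j / ħ j) l (𝓝 0)) (hψ_norm : ∀ᶠ j in l, ‖ψ j‖ = 1)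
    (hψ_low : Tendsto
      (fun δ : ℝ => limsup (fun j => ‖spectralProjector (ħ j) (Set.Icc 0 δ) (ψ j)‖ₑ) l)
      (𝓝[>] 0) (𝓝 0)) :
    IsOscillating l (fun j => 4 * Real.pi ^ 2 * ħ j ^ 2 / ε j) ψ := by
  have hħ_pos : ∀ᶠ j in l, 0 < ħ j := (tendsto_nhdsWithin_iff.1 hħ).2
  refine ⟨?_, ?_, hψ_norm, fun R => ?_⟩
  · filter_upwards [hħ_pos, hε_pos] with j h1 h2
    positivity
  · have := hε_large.const_mul (4 * Real.pi ^ 2)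
    rw [mul_zero] at this
    exact this.congr fun j => (mul_div_assoc _ _ _).symm
  · rw [Metric.tendsto_nhds]
    intro ρ hρ
    have hρ' : (0 : ℝ≥0∞) < ENNReal.ofReal ρ := ENNReal.ofReal_pos.2 hρ
    obtain ⟨δ, hδ, hδ0⟩ := ((hψ_low.eventually_lt_const hρ').and self_mem_nhdsWithin).exists
    have hδ0' : 0 < δ := hδ0
    have hsmall : ∀ᶠ j in l, ‖spectralProjector (ħ j) (Set.Icc 0 δ) (ψ j)‖ₑ
        < ENNReal.ofReal ρ := eventually_lt_of_limsup_lt hδ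
    -- On this set of frequencies, `ħ² |m|²` is at most a multiple of `(ε / ħ)²`.
    have hratio : Tendsto (fun j => R / (4 * Real.pi ^ 2) * (ε j / ħ j) ^ 2) l (𝓝 0) := by
      simpa using (hε_small.pow 2).const_mul (R / (4 * Real.pi ^ 2))
    filter_upwards [hsmall, hħ_pos, hε_pos, hratio.eventually_le_const hδ0'] with j h1 h2 h3 h4
    rw [Real.dist_0_eq_abs, abs_of_nonneg (norm_nonneg _)]
    have hsub : {m | (4 * Real.pi ^ 2 * ħ j ^ 2 / ε j) ^ 2 * freqSq m ≤ R}
        ⊆ {m | laplaceEigenvalue (ħ j) m ∈ Set.Icc 0 δ} := by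
      intro m hm
      rw [Set.mem_ofPred_eq] at hm ⊢
      have h5 : laplaceEigenvalue (ħ j) m = ((4 * Real.pi ^ 2 * ħ j ^ 2 / ε j) ^ 2 * freqSq m)
          / (4 * Real.pi ^ 2) * (ε j / ħ j) ^ 2 := by
        rw [laplaceEigenvalue, freqSq]
        have := Real.pi_pos
        field_simp
      have h6 := freqSq_nonneg m
      refine ⟨?_, le_trans ?_ h4⟩
      · rw [h5]
        positivity
      · rw [h5]
        gcongr
    refine (norm_wshift_indicator_mono hsub (ψ j)).trans_lt ?_
    rw [← spectralProjector_eq]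
    rw [← ofReal_norm] at h1
    exact (ENNReal.ofReal_lt_ofReal_iff hρ).1 h1

lemma hasTwoMicrolocalMeasures_of_twoMicrolocal {v : PrimitiveLattice → Freq}
    (hv : ∀ Λ, AddSubgroup.zmultiples (v Λ) = Λ.1)
    {F : PrimitiveLattice → Measure (Torus × ℝ)}
    (hF : ∀ (Λ : PrimitiveLattice) (a : Torus × ℝ → ℂ), IsTestFunction a →
      Tendsto (fun j => twoMicrolocal (v Λ) (ħ j) (ε j) (ψ j) a) l (𝓝 (∫ p, a p ∂(F Λ)))) :
    HasTwoMicrolocalMeasures l (fun j => 4 * Real.pi ^ 2 * ħ j ^ 2 / ε j) ψ v F := by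
  intro Λ P hP f hfc hfs
  obtain ⟨C, hC⟩ := hfs.exists_bound_of_continuous hfc.continuous
  have hdet := (mem_lattice_iff Λ (generator_mem (hv Λ)) (generator_ne_zero (hv Λ)) P).1 hP
  have htest : IsTestFunction fun p : Torus × ℝ => UnitAddTorus.mFourier P p.1 * f p.2 := by
    refine ⟨((contDiff_mFourier_proj P).comp contDiff_fst).mul (hfc.comp contDiff_snd), ?_⟩
    refine HasCompactSupport.intro (K := Set.univ ×ˢ tsupport f) (isCompact_univ.prod hfs) ?_
    rintro ⟨x, η⟩ hp
    have : η ∉ tsupport f := fun h => hp ⟨trivial, h⟩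
    simp [image_eq_zero_of_notMem_tsupport this]
  refine (hF Λ _ htest).congr fun j => ?_
  exact twoMicrolocal_eq_inner (generator_ne_zero (hv Λ)) hdet (ħ j) (ε j) (ψ j) hC

end Hypotheses

/-! ### Overlaps in the interaction picture -/

/-- Overlaps with the unperturbed solution are overlaps with the initial data in the interaction
picture. -/
lemma inner_eq_inner_interaction {h ε : ℝ} (hh : 0 < h) (hε : 0 < ε) {ψ : L2Torus}
    {u : ℝ → L2Torus} (hu : IsSchrodingerSolution h (fun _ => 0) ψ u) (φ : L2Torus) (t : ℝ) :
    (inner ℂ φ (u (t * (h / ε))) : ℂ)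
      = inner ℂ (freeFlow (-(4 * Real.pi ^ 2 * h ^ 2 / ε * t)) φ) ψ := by
  have hu' : IsSchrodingerSolution h (fun x => ε * (fun _ => 0 : Torus → ℝ) x) ψ u := by
    simpa using hu
  have h1 : ∀ s, HasDerivAt (fun s => freeFlow (-(4 * Real.pi ^ 2 * h ^ 2 / ε * s))
      (u (s * (h / ε)))) 0 s := fun s => by
    have := hu'.hasDerivAt_interaction hh hε (Z := 0) (by simp) s
    simpa [heisenberg_apply] using this
  have h2 := is_const_of_deriv_eq_zero (fun s => (h1 s).differentiableAt)
    (fun s => (h1 s).deriv) t 0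
  simp only [mul_zero, zero_mul, neg_zero, freeFlow_zero, hu.initial] at h2
  rw [inner_freeFlow_left, neg_neg, ← h2, freeFlow_freeFlow_neg]

/-- The limit symbol of the echo. -/
def echoSymbol (v : PrimitiveLattice → Freq) (V : Torus → ℝ) (t : ℝ) (y : LimitPoint) : ℂ :=
  Complex.exp (Complex.I * ((∫ s in (0 : ℝ)..t, orbitAverage v V y s : ℝ) : ℂ))

lemma isBoundedSymbol_echoSymbol (v : PrimitiveLattice → Freq) (V : C(Torus, ℝ)) (t : ℝ) :
    IsBoundedSymbol (echoSymbol v V t) := by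
  refine ⟨⟨1, fun y => ?_⟩, fun Λ => Continuous.measurable ?_⟩
  · rw [echoSymbol, mul_comm, Complex.norm_exp_ofReal_mul_I]
  · have h1 : Continuous fun p : Torus × ℝ =>
        ∫ s in (0 : ℝ)..t, orbitAverage v V (some (Λ, p)) s :=
      intervalIntegral.continuous_parametric_intervalIntegral_of_continuous'
        (f := fun p s => orbitAverage v V (some (Λ, p)) s)
        (continuous_orbitAverage_uncurry v V Λ) _ _
    unfold echoSymbol
    fun_prop

/-- The symbol of the sliced evolution of an approximate potential is uniformly close to the symbol
of the echo. -/
lemma norm_prod_sliceSymbol_sub_echoSymbol_le {v : PrimitiveLattice → Freq}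
    (hv : ∀ Λ, AddSubgroup.zmultiples (v Λ) = Λ.1) {V Z : C(Torus, ℝ)} {S : Finset Freq}
    {c : Freq → ℂ} (hZ : ∀ x, (Z x : ℂ) = ∑ p ∈ S, c p * UnitAddTorus.mFourier p x)
    {C δ Δ : ℝ} (hC : ∀ x, |Z x| ≤ C) (hδ : ∀ x, |V x - Z x| ≤ δ) {s : ℕ → ℝ}
    (hs : ∀ k, |s k - s (k + 1)| ≤ Δ) (hΔ : C * Δ ≤ 1) {n : ℕ} (hsn : s n = 0)
    (y : LimitPoint) :
    ‖∏ k ∈ Finset.range n, (1 + Complex.I * sliceSymbol v S c (s (k + 1)) (s k) y)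
      - echoSymbol v V (s 0) y‖ ≤ n * ((C * Δ) ^ 2 * (1 + C * Δ) ^ n) + δ * |s 0| := by
  have hv0 : ∀ Λ, v Λ ≠ 0 := fun Λ => generator_ne_zero (hv Λ)
  have hC0 : 0 ≤ C := (abs_nonneg _).trans (hC 0)
  have hint : ∀ (W : C(Torus, ℝ)) a b, IntervalIntegrable (orbitAverage v W y) volume a b :=
    fun W a b => (continuous_orbitAverage v W y).intervalIntegrable a b
  set φ : ℕ → ℝ := fun k => ∫ r in s (k + 1)..s k, orbitAverage v Z y r with hφ
  have hφb : ∀ k, |φ k| ≤ C * Δ := fun k => by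
    have := intervalIntegral.norm_integral_le_of_norm_le_const (a := s (k + 1)) (b := s k)
      (f := orbitAverage v Z y) fun r _ => abs_orbitAverage_le hv0 hC y r
    exact this.trans (by gcongr; exact hs k)
  have hsum : ∑ k ∈ Finset.range n, φ k = ∫ r in (0 : ℝ)..s 0, orbitAverage v Z y r := by
    have := intervalIntegral.sum_integral_adjacent_intervals (f := orbitAverage v Z y)
      (μ := volume) (a := s) (n := n) fun k _ => hint Z _ _
    rw [hsn] at this
    rw [intervalIntegral.integral_symm, ← this, ← Finset.sum_neg_distrib]
    exact Finset.sum_congr rfl fun k _ => intervalIntegral.integral_symm _ _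
  have h1 := norm_prod_one_add_sub_exp_le φ hΔ hφb n
  rw [hsum] at h1
  have h2 : |(∫ r in (0 : ℝ)..s 0, orbitAverage v Z y r)
      - ∫ r in (0 : ℝ)..s 0, orbitAverage v V y r| ≤ δ * |s 0| := by
    rw [← intervalIntegral.integral_sub (hint Z _ _) (hint V _ _)]
    have := intervalIntegral.norm_integral_le_of_norm_le_const (a := 0) (b := s 0) (C := δ)
      (f := fun r => orbitAverage v Z y r - orbitAverage v V y r) fun r _ => by
        rw [orbitAverage_sub, Real.norm_eq_abs]
        exact abs_orbitAverage_le hv0 (fun x => by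
          rw [Pi.sub_apply, abs_sub_comm]
          exact hδ x) y r
    simpa using this
  simp only [sliceSymbol_eq hv hZ]
  refine (norm_sub_le_norm_sub_add_norm_sub _ _ _).trans (add_le_add h1 ?_)
  exact (norm_exp_I_mul_sub_le _ _).trans h2

/-! ### The limit of the echo -/

lemma isOpenQuotientMap_proj : IsOpenQuotientMap proj :=
  IsOpenQuotientMap.piMap fun _ => QuotientAddGroup.isOpenQuotientMap_mk

lemma continuous_of_smoothOnTorus {V : Torus → ℝ} (hV : SmoothOnTorus V) : Continuous V :=
  isOpenQuotientMap_proj.isQuotientMap.continuous_iff.2 (ContDiff.continuous hV)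

end

end LoschmidtEcho

theorem theorem1
    {ι : Type*} (l : Filter ι) [l.NeBot] [l.IsCountablyGenerated]
    -- the semiclassical parameter and the size of the perturbation, `ħ² ≪ ε_ħ ≪ ħ`
    (ħ ε : ι → ℝ)
    (hħ : Tendsto ħ l (𝓝[>] 0))
    (hε_pos : ∀ᶠ j in l, 0 < ε j)
    (hε_large : Tendsto (fun j => ħ j ^ 2 / ε j) l (𝓝 0))
    (hε_small : Tendsto (fun j => ε j / ħ j) l (𝓝 0))
    -- the potential
    (V : Torus → ℝ) (hV : SmoothOnTorus V)
    -- the normalized initial data, oscillating at the frequency `ħ⁻¹`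
    (ψ : ι → L2Torus)
    (hψ_norm : ∀ᶠ j in l, ‖ψ j‖ = 1)
    (hψ_low : Tendsto
      (fun δ : ℝ => limsup (fun j => ‖spectralProjector (ħ j) (Set.Icc 0 δ) (ψ j)‖ₑ) l)
      (𝓝[>] 0) (𝓝 0))
    (hψ_high : Tendsto
      (fun R : ℝ => limsup (fun j => ‖spectralProjector (ħ j) (Set.Ici R) (ψ j)‖ₑ) l)
      atTop (𝓝 0))
    -- generators of the primitive sublattices of rank one
    (v : PrimitiveLattice → Fin 2 → ℤ)
    (hv : ∀ Λ : PrimitiveLattice, AddSubgroup.zmultiples (v Λ) = Λ.1)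
    -- the two-microlocal measures generated by the initial data
    (F : PrimitiveLattice → Measure (Torus × ℝ)) [∀ Λ, IsFiniteMeasure (F Λ)]
    (hF : ∀ (Λ : PrimitiveLattice) (a : Torus × ℝ → ℂ), IsTestFunction a →
      Tendsto (fun j => twoMicrolocal (v Λ) (ħ j) (ε j) (ψ j) a) l (𝓝 (∫ p, a p ∂(F Λ))))
    -- the solutions of the unperturbed and of the perturbed Schrödinger equations
    (u uε : ι → ℝ → L2Torus)
    (hu : ∀ᶠ j in l, IsSchrodingerSolution (ħ j) (fun _ => 0) (ψ j) (u j))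
    (huε : ∀ᶠ j in l, IsSchrodingerSolution (ħ j) (fun x => ε j * V x) (ψ j) (uε j)) :
    (Summable fun Λ : PrimitiveLattice => (F Λ).real Set.univ) ∧
    ∀ t : ℝ,
      Tendsto
        (fun j => inner ℂ (uε j (t * (ħ j / ε j))) (u j (t * (ħ j / ε j)))) l
        (𝓝 (Complex.exp (Complex.I * t * ((∫ x, V x ∂torusMeasure : ℝ) : ℂ)) *
              (1 - ((∑' Λ : PrimitiveLattice, (F Λ).real Set.univ : ℝ) : ℂ))
            + ∑' Λ : PrimitiveLattice, ∫ p : Torus × ℝ,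
                Complex.exp (Complex.I * ((∫ s in (0 : ℝ)..t,
                  latticeAverage (v Λ) V (p.1 + proj ((s * p.2) • unitVec (v Λ))) : ℝ) : ℂ))
                ∂(F Λ))) := by
  set Vc : C(Torus, ℝ) := ⟨V, continuous_of_smoothOnTorus hV⟩ with hVc
  have hψ := isOscillating_of_spectralProjector hħ hε_pos hε_large hε_small hψ_norm hψ_low
  have hF' := hasTwoMicrolocalMeasures_of_twoMicrolocal hv hF
  have hsum := summable_resonant_mass hψ hv hF'
  refine ⟨hsum, fun t => ?_⟩
  have htarget : meanValue F (echoSymbol v Vc t)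
      = Complex.exp (Complex.I * t * ((∫ x, V x ∂torusMeasure : ℝ) : ℂ)) *
          (1 - ((∑' Λ : PrimitiveLattice, (F Λ).real Set.univ : ℝ) : ℂ))
        + ∑' Λ : PrimitiveLattice, ∫ p : Torus × ℝ,
            Complex.exp (Complex.I * ((∫ s in (0 : ℝ)..t,
              latticeAverage (v Λ) V (p.1 + proj ((s * p.2) • unitVec (v Λ))) : ℝ) : ℂ))
            ∂(F Λ) := by
    have hnone : echoSymbol v Vc t none
        = Complex.exp (Complex.I * t * ((∫ x, V x ∂torusMeasure : ℝ) : ℂ)) := by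
      simp only [echoSymbol, orbitAverage, hVc, ContinuousMap.coe_mk]
      rw [intervalIntegral.integral_const, sub_zero, smul_eq_mul, Complex.ofReal_mul, mul_assoc]
    rw [meanValue, hnone]
    rfl
  rw [← htarget]
  refine tendsto_of_forall_approx fun η hη => ?_
  -- `C` bounds both the potential and its trigonometric approximation `Z`, as `δ ≤ 1`.
  set C : ℝ := ‖Vc‖ + 1 with hC
  have hCpos : 0 < C := by positivity
  set M : ℝ := ‖1 - ((∑' Λ, (F Λ).real Set.univ : ℝ) : ℂ)‖ + ∑' Λ, (F Λ).real Set.univ with hM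
  have hM0 : 0 ≤ M := add_nonneg (norm_nonneg _) (tsum_nonneg fun Λ => measureReal_nonneg)
  set Q : ℝ := |t| * Real.exp (C * |t|) with hQ
  have hQ0 : 0 ≤ Q := by positivity
  set K : ℝ := Q * (1 + M) + 1 with hK
  have hK0 : 0 < K := by positivity
  set δ : ℝ := min 1 (η / (2 * K)) with hδ
  have hδ0 : 0 < δ := lt_min one_pos (by positivity)
  obtain ⟨Z, S, c, hZ, hVZ⟩ := exists_trigonometric_approx Vc hδ0
  obtain ⟨n, ⟨hn1, hn2⟩, hn0⟩ : ∃ n : ℕ, (C ^ 2 * |t| / n ≤ η / (2 * K) ∧ C * |t| / n ≤ 1)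
      ∧ 0 < n :=
    ((((tendsto_const_div_atTop_nhds_zero_nat (C ^ 2 * |t|)).eventually_le_const
      (by positivity)).and ((tendsto_const_div_atTop_nhds_zero_nat (C * |t|)).eventually_le_const
      one_pos)).and (eventually_gt_atTop 0)).exists
  have hnR : (0 : ℝ) < n := by exact_mod_cast hn0
  set Δ : ℝ := |t| / n with hΔ
  set s : ℕ → ℝ := fun k => t - k * (t / n) with hs
  have hs0 : s 0 = t := by simp [hs]
  have hsn : s n = 0 := by
    simp only [hs]
    field_simp
    ring
  have hsΔ : ∀ k, |s k - s (k + 1)| ≤ Δ := fun k => by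
    have h1 : s k - s (k + 1) = t / n := by
      simp only [hs]
      push_cast
      ring
    rw [h1, abs_div, abs_of_pos hnR]
  have hCΔ : C * Δ ≤ 1 := by rwa [hΔ, ← mul_div_assoc]
  have hΔ0 : 0 ≤ Δ := by positivity
  -- Both the slicing of the evolution and that of the limit symbol cost at most `e`.
  set e : ℝ := (C ^ 2 * Δ + δ) * Q with he
  have hpow : (1 + C * Δ) ^ n ≤ Real.exp (C * |t|) := by
    have h1 : 1 + C * Δ ≤ Real.exp (C * Δ) := by
      rw [add_comm]
      exact Real.add_one_le_exp _
    calc (1 + C * Δ) ^ n ≤ Real.exp (C * Δ) ^ n := by gcongr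
      _ = Real.exp (C * |t|) := by
        rw [← Real.exp_nat_mul, hΔ]
        congr 1
        field_simp
  have hnΔ : n * Δ = |t| := by
    rw [hΔ]
    field_simp
  have heM : e * (1 + M) ≤ η := by
    have h1 : C ^ 2 * Δ + δ ≤ η / K := by
      have h2 : C ^ 2 * Δ ≤ η / (2 * K) := by rwa [hΔ, ← mul_div_assoc]
      have h3 : δ ≤ η / (2 * K) := min_le_right _ _
      calc _ ≤ η / (2 * K) + η / (2 * K) := add_le_add h2 h3
        _ = η / K := by
          field_simp
          ring
    calc e * (1 + M) = (C ^ 2 * Δ + δ) * (Q * (1 + M)) := by ring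
      _ ≤ η / K * K := by
        gcongr
        linarith
      _ = η := by field_simp
  have he0 : 0 ≤ e := by positivity
  have heη : e ≤ η := by nlinarith
  have hVle : ∀ x, |Vc x| ≤ ‖Vc‖ := fun x => Vc.norm_coe_le_norm x
  have hZC : ∀ x, |Z x| ≤ C := fun x => by
    have h1 := hVle x
    have h2 := hVZ x
    have h3 : δ ≤ 1 := min_le_left _ _
    have h4 := abs_sub_abs_le_abs_sub (Z x) (Vc x)
    rw [abs_sub_comm] at h4
    linarith
  set Vℂ : C(Torus, ℂ) := ⟨fun x => (Vc x : ℂ), by fun_prop⟩ with hVℂ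
  set Zℂ : C(Torus, ℂ) := ⟨fun x => (Z x : ℂ), by fun_prop⟩ with hZℂ
  have hZsum : Zℂ = ∑ p ∈ S, c p • UnitAddTorus.mFourier p := by
    ext x
    simp only [hZℂ, ContinuousMap.coe_mk, hZ, ContinuousMap.coe_sum, Finset.sum_apply,
      ContinuousMap.smul_apply, smul_eq_mul]
  have hVnorm : ‖Vℂ‖ ≤ C := by
    refine (ContinuousMap.norm_le _ hCpos.le).2 fun x => ?_
    rw [hVℂ, ContinuousMap.coe_mk, Complex.norm_real, Real.norm_eq_abs]
    linarith [hVle x]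
  have hZnorm : ‖Zℂ‖ ≤ C := by
    refine (ContinuousMap.norm_le _ hCpos.le).2 fun x => ?_
    rw [hZℂ, ContinuousMap.coe_mk, Complex.norm_real, Real.norm_eq_abs]
    exact hZC x
  have hVZnorm : ‖Vℂ - Zℂ‖ ≤ δ := by
    refine (ContinuousMap.norm_le _ hδ0.le).2 fun x => ?_
    change ‖(Vc x : ℂ) - (Z x : ℂ)‖ ≤ δ
    rw [← Complex.ofReal_sub, Complex.norm_real, Real.norm_eq_abs]
    exact hVZ x
  obtain ⟨hbdd, hlim⟩ := tendsto_inner_backwardSlices hψ hv hF' hZsum s n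
  refine ⟨_, _, hlim, ?_, ?_⟩
  · refine (norm_meanValue_sub_le (η := e) hsum hbdd (isBoundedSymbol_echoSymbol v Vc t)
      fun y => ?_).trans ?_
    · have h1 := norm_prod_sliceSymbol_sub_echoSymbol_le hv hZ hZC hVZ hsΔ hCΔ hsn y
      rw [hs0] at h1
      refine h1.trans ?_
      have h2 : |t| ≤ Q := le_mul_of_one_le_right (abs_nonneg t)
        (Real.one_le_exp (by positivity))
      calc n * ((C * Δ) ^ 2 * (1 + C * Δ) ^ n) + δ * |t|
          = C ^ 2 * Δ * ((n * Δ) * (1 + C * Δ) ^ n) + δ * |t| := by ring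
        _ ≤ C ^ 2 * Δ * Q + δ * Q := by
          rw [hnΔ]
          gcongr
          rw [hQ]
          gcongr
        _ = e := by ring
    · linarith
  · filter_upwards [hψ_norm, hu, huε, (tendsto_nhdsWithin_iff.1 hħ).2, hε_pos]
      with j h1 h2 h3 h4 h5
    set κ := 4 * Real.pi ^ 2 * ħ j ^ 2 / ε j with hκ
    -- The perturbed solution in the interaction picture.
    set w : ℝ → L2Torus := fun r => freeFlow (-(κ * r)) (uε j (r * (ħ j / ε j))) with hw
    have hw' : ∀ r, HasDerivAt w (-Complex.I • heisenberg κ Vℂ r (w r)) r := fun r =>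
      h3.hasDerivAt_interaction h4 h5 (fun x => rfl) r
    have hw0 : w 0 = ψ j := by simp [hw, freeFlow_zero, h3.initial]
    have h6 := norm_inner_sub_backwardSlices_le (B := heisenberg κ Vℂ) (B' := heisenberg κ Zℂ)
      hCpos.le hδ0.le
      (fun r φ => (norm_heisenberg_le κ Vℂ r φ).trans (by gcongr))
      (fun r φ => (norm_heisenberg_le κ Zℂ r φ).trans (by gcongr))
      (fun r φ => by
        rw [heisenberg_sub]
        exact (norm_heisenberg_le κ _ r φ).trans (by gcongr))
      (fun r φ χ => inner_heisenberg_left κ (fun x => Complex.conj_ofReal _) r φ χ)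
      (fun φ => continuous_heisenberg κ Zℂ continuous_const) hw' (by rw [hw0, h1]) hsΔ (ψ j) n
    rw [hs0, hsn, hw0, h1, mul_one] at h6
    rw [inner_eq_inner_interaction h4 h5 h2]
    refine (h6.trans ?_).trans heη
    calc n * ((C ^ 2 * Δ + δ) * Δ * (1 + C * Δ) ^ n)
        = (C ^ 2 * Δ + δ) * ((n * Δ) * (1 + C * Δ) ^ n) := by ring
      _ ≤ e := by
        rw [hnΔ, he, hQ]
        gcongr
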